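/- Let $d\ge 2$ and $n\ge 1$ be integers. An unknown $V\in SU(d)$ is parametrized as $V=V(\theta)$ with $\theta$ in an open subset of $\mathbb R^{d^2-1}$; the parametrization is differentiable at the true value $\theta$ and is normalized there by $\operatorname{tr}(t_\alpha t_\beta)=\delta_{\alpha\beta}$, where $t_\alpha=iV^\dagger\partial_\alpha V$. For an input state $\omega$ on $\mathbb C^{d_A}\otimes(\mathbb C^d)^{\otimes n}$ let $\rho_n(\theta,\omega)=(1_A\otimes V(\theta)^{\otimes n})\,\omega\,(1_A\otimes V(\theta)^{\otimes n})^\dagger$ be the output state. Let $H_n(\theta,\omega)$ be its quantum Fisher information matrix, $H_{\alpha\beta}=\operatorname{tr}[\rho\,(\lambda_\alpha\circ\lambda_\beta)]$, where $A\circ B=(AB+BA)/2$ and the $\lambda_\alpha$ are selfadjoint solutions of $\partial_\alpha\rho=\rho\circ\lambda_\alpha$. Let $$C_n(\theta,\omega,\mathbb I)=\lim_{N\to\infty}N\inf_M\operatorname{Tr}\big[I_n(\theta,M,\omega)^{[N]}\big]^{-1},$$ where $I_n(\theta,M,\omega)^{[N]}$ is the classical Fisher information matrix of the POVM $M$ (with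 finitely many outcomes) on $\rho_n(\theta,\omega)^{\otimes N}$, the infimum is over all such POVMs on the $N$ copies, and $\operatorname{Tr}I^{-1}=+\infty$ if $I$ is singular (a lower limit is understood where the limit is not known to exist). For unitaries $U_1,\dots,U_m\in U(d)$ let $\omega=|\Omega\rangle\langle\Omega|$ be the approximate-design input state, $$|\Omega\rangle=\frac1{\sqrt{md}}\sum_{k=1}^d\sum_{b=1}^m|bk\rangle\otimes\big[U_b|k\rangle\big]^{\otimes n},$$ and put $H_n^0=\frac{4n(n+d)}{d(d+1)}\mathbb I$. 1. Let $0<\varepsilon\le\frac12$ and let $m$ be an integer with $$m>\frac{4(d+1)\ln 2}{\varepsilon^2}\,\ln\big[2(d^2-1)\big].$$ Then there is a choice of $U_1,\dots,U_m$ such that, for every such parametrization and true value $\theta$, the matrix $H_n=H_n(\theta,\omega)$ is positive definite, $$(1-\varepsilon)[H_n^0]^{-1}\le H_n^{-1}\le(1+\varepsilon)[H_n^0]^{-1},$$ the limit $C_n(\theta,\omega,\mathbb I)$ exists, and $$C_n(\theta,\omega,\mathbb I)\le(1+\varepsilon)\,\frac{d(d+1)^2(d-1)}{4n(n+d)}.$$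 2. Every input state $\omega'$, pure or mixed and with any finite-dimensional ancilla, satisfies $C_n(\theta,\omega',\mathbb I)\ge\frac{d(d+1)^2(d-1)}{4n(n+d)}$. 3. Hence optimality can be approached arbitrarily closely without exact 2-designs: for every $\delta>0$ there is $m_0$ such that for every $m\ge m_0$ some choice of $U_1,\dots,U_m$ gives, for every such parametrization and $\theta$, $$\frac{d(d+1)^2(d-1)}{4n(n+d)}\le C_n(\theta,\omega,\mathbb I)\le\frac{d(d+1)^2(d-1)}{4n(n+d)}+\delta.$$ -/

import Mathlib

open Filter Topology
open scoped ENNReal Kronecker Matrix ComplexOrder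

noncomputable section

namespace UnitaryEstimation

/-- The `k`-fold tensor power `A ⊗ ⋯ ⊗ A` of a square matrix, in the product basis, which is indexed
by functions `Fin k → ι`. -/
def tensorPow {ι : Type} (k : ℕ) (A : Matrix ι ι ℂ) : Matrix (Fin k → ι) (Fin k → ι) ℂ :=
  Matrix.of fun x y => ∏ s, A (x s) (y s)

/-- The entrywise partial derivative `∂F/∂θ_α` of a matrix valued function at the point `θ`. -/
def partialDeriv {p : ℕ} {ι : Type} (F : (Fin p → ℝ) → Matrix ι ι ℂ) (θ : Fin p → ℝ) (α : Fin p) :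
    Matrix ι ι ℂ :=
  Matrix.of fun i j => lineDeriv ℝ (fun η => F η i j) θ (Pi.single α 1)

/-- The generators `t_α = i V(θ)† ∂_α V(θ)` of a parametrization `V` at `θ`. -/
def generator {d p : ℕ} (V : (Fin p → ℝ) → Matrix (Fin d) (Fin d) ℂ) (θ : Fin p → ℝ) (α : Fin p) :
    Matrix (Fin d) (Fin d) ℂ :=
  Complex.I • ((V θ)ᴴ * partialDeriv V θ α)

/-- `V` is a parametrization of `SU(d)` by `d² - 1` real parameters on the open set `Θ`, it is
differentiable at `θ ∈ Θ`, and it is normalized there by `tr (t_α t_β) = δ_{αβ}`. -/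
structure IsNormalizedParametrization {d : ℕ} (Θ : Set (Fin (d ^ 2 - 1) → ℝ))
    (V : (Fin (d ^ 2 - 1) → ℝ) → Matrix (Fin d) (Fin d) ℂ) (θ : Fin (d ^ 2 - 1) → ℝ) : Prop where
  isOpen : IsOpen Θ
  mem : θ ∈ Θ
  special_unitary : ∀ η ∈ Θ, V η ∈ Matrix.specialUnitaryGroup (Fin d) ℂ
  differentiableAt : ∀ i j, DifferentiableAt ℝ (fun η => V η i j) θ
  normalized : ∀ α β, (generator V θ α * generator V θ β).trace = if α = β then 1 else 0

/-- A density matrix. -/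
def IsDensityMatrix {ι : Type} [Fintype ι] (ω : Matrix ι ι ℂ) : Prop :=
  ω.PosSemidef ∧ ω.trace = 1

/-- The output state `(1_A ⊗ V(θ)^{⊗n}) ω (1_A ⊗ V(θ)^{⊗n})†` for the input state `ω` on
`ℂ^A ⊗ (ℂ^d)^{⊗n}`, as a function of the parameter. -/
def outputState {d n p : ℕ} {A : Type} [Fintype A] [DecidableEq A]
    (V : (Fin p → ℝ) → Matrix (Fin d) (Fin d) ℂ)
    (ω : Matrix (A × (Fin n → Fin d)) (A × (Fin n → Fin d)) ℂ) (θ : Fin p → ℝ) :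
    Matrix (A × (Fin n → Fin d)) (A × (Fin n → Fin d)) ℂ :=
  ((1 : Matrix A A ℂ) ⊗ₖ tensorPow n (V θ)) * ω * ((1 : Matrix A A ℂ) ⊗ₖ tensorPow n (V θ))ᴴ

/-- Positive operator valued measures with finitely many outcomes. -/
structure POVM (ι : Type) [Fintype ι] [DecidableEq ι] where
  outcomes : ℕ
  element : Fin outcomes → Matrix ι ι ℂ
  posSemidef : ∀ ξ, (element ξ).PosSemidef
  sum_eq_one : ∑ ξ, element ξ = 1

open Classical in
/-- The (classical) Fisher information matrix at `θ` of the measurement `M` on the family of states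
`ρ`. The sum runs over the outcomes of positive probability. -/
def fisherInfo {ι : Type} [Fintype ι] [DecidableEq ι] {p : ℕ} (ρ : (Fin p → ℝ) → Matrix ι ι ℂ)
    (θ : Fin p → ℝ) (M : POVM ι) : Matrix (Fin p) (Fin p) ℝ :=
  Matrix.of fun α β => ∑ ξ with 0 < (ρ θ * M.element ξ).trace.re,
    (partialDeriv ρ θ α * M.element ξ).trace.re * (partialDeriv ρ θ β * M.element ξ).trace.re /
      (ρ θ * M.element ξ).trace.re

/-- `L` is a family of symmetric logarithmic derivatives of `ρ` at `θ`: each `L α` is selfadjoint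
and `∂_α ρ = (ρ L_α + L_α ρ) / 2`. -/
def IsSLD {ι : Type} [Fintype ι] {p : ℕ} (ρ : (Fin p → ℝ) → Matrix ι ι ℂ)
    (θ : Fin p → ℝ) (L : Fin p → Matrix ι ι ℂ) : Prop :=
  ∀ α, (L α).IsHermitian ∧ partialDeriv ρ θ α = (1 / 2 : ℂ) • (ρ θ * L α + L α * ρ θ)

/-- The quantum Fisher information `H_{αβ} = tr [ρ (L_α L_β + L_β L_α) / 2]` of the state `ρ` with
symmetric logarithmic derivatives `L`. The trace is real. -/
def quantumFisherInfo {ι : Type} [Fintype ι] {p : ℕ} (ρ : Matrix ι ι ℂ)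
    (L : Fin p → Matrix ι ι ℂ) : Matrix (Fin p) (Fin p) ℝ :=
  Matrix.of fun α β => (ρ * ((1 / 2 : ℂ) • (L α * L β + L β * L α))).trace.re

open Classical in
/-- `Tr I⁻¹` for an information matrix `I`, with the value `+∞` when `I` is singular. -/
def traceInv {p : ℕ} (I : Matrix (Fin p) (Fin p) ℝ) : ℝ≥0∞ :=
  if I.PosDef then ENNReal.ofReal (I⁻¹).trace else ⊤

/-- `N · min_M Tr [I_n(θ, M, ω)^{[N]}]⁻¹`: here `M` runs over all (collective) measurements of `N`
copies of the output state. -/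
def scaledCost {d n p : ℕ} {A : Type} [Fintype A] [DecidableEq A]
    (V : (Fin p → ℝ) → Matrix (Fin d) (Fin d) ℂ) (θ : Fin p → ℝ)
    (ω : Matrix (A × (Fin n → Fin d)) (A × (Fin n → Fin d)) ℂ) (N : ℕ) : ℝ≥0∞ :=
  (N : ℝ≥0∞) * ⨅ M : POVM (Fin N → A × (Fin n → Fin d)),
    traceInv (fisherInfo (fun η => tensorPow N (outputState V ω η)) θ M)

/-- The figure of merit `C_n(θ, ω, 𝕀) = lim_{N → ∞} N · min_M Tr [I_n(θ, M, ω)^{[N]}]⁻¹`. It is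
written as a lower limit so that it is meaningful for every input state; it is the limit whenever
the limit exists. -/
def figureOfMerit {d n p : ℕ} {A : Type} [Fintype A] [DecidableEq A]
    (V : (Fin p → ℝ) → Matrix (Fin d) (Fin d) ℂ) (θ : Fin p → ℝ)
    (ω : Matrix (A × (Fin n → Fin d)) (A × (Fin n → Fin d)) ℂ) : ℝ≥0∞ :=
  liminf (fun N => scaledCost V θ ω N) atTop

/-- The vector `|Ω⟩ = (m d)^{-1/2} ∑_{k,b} |b k⟩ ⊗ (U_b |k⟩)^{⊗n}` of the approximate-design input
state, with ancilla basis `|b k⟩`. -/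
def designVector {d m : ℕ} (n : ℕ) (U : Fin m → Matrix.unitaryGroup (Fin d) ℂ) :
    (Fin m × Fin d) × (Fin n → Fin d) → ℂ :=
  fun x => ((1 / Real.sqrt ((m : ℝ) * d) : ℝ) : ℂ) *
    ∏ s, (U x.1.1 : Matrix (Fin d) (Fin d) ℂ) (x.2 s) x.1.2

/-- The approximate-design input state `ω = |Ω⟩⟨Ω|`. -/
def designState {d m : ℕ} (n : ℕ) (U : Fin m → Matrix.unitaryGroup (Fin d) ℂ) :
    Matrix ((Fin m × Fin d) × (Fin n → Fin d)) ((Fin m × Fin d) × (Fin n → Fin d)) ℂ :=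
  Matrix.vecMulVec (designVector n U) (star (designVector n U))

/-- The optimal quantum Fisher information `H⁰_n = 4 n (n + d) / (d (d + 1)) 𝕀`. -/
def optimalQFI (d n : ℕ) : Matrix (Fin (d ^ 2 - 1)) (Fin (d ^ 2 - 1)) ℝ :=
  (4 * (n : ℝ) * (n + d) / (d * (d + 1))) • (1 : Matrix (Fin (d ^ 2 - 1)) (Fin (d ^ 2 - 1)) ℝ)

/-- The optimal value `d (d + 1)² (d - 1) / (4 n (n + d))` of the figure of merit. -/
def optimalCost (d n : ℕ) : ℝ :=
  (d : ℝ) * (d + 1) ^ 2 * (d - 1) / (4 * n * (n + d))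

end UnitaryEstimation

end

/-! Write the derivative of the output state as a commutator `-i[K_α, ρ]`, where `K_α` is the
collective generator `∑ s, t_α` at site `s`, conjugated by the output unitary. Everything is then
expressed through first and second moments of these generators.

Lower bound. Cauchy–Schwarz, outcome by outcome, bounds the Fisher information of any measurement by
four times the second moments of the generators (`fisherInfo_quadForm_le`). After subtracting means,
`N` copies give at most `N` times the one-copy bound. Normalization makes the `t_α` an orthonormal
basis of the traceless selfadjoint matrices, so `∑ t_α ⊗ t_α` is the swap minus `1/d`. As the swap
is at most `1`, the total second moment is at most `n(n+d)(d-1)/d`, for mixed inputs too. Finally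
`Tr I⁻¹ ≥ p²/Tr I` with `p = d² - 1`.

Attainment. The reduced state of `|Ω⟩` on the probes is a uniform mixture of the product states
`(U_b|k⟩)^{⊗n}`. Hence the generators are centred and their Gram matrix is real. For a pure state
with real Gram matrix a measurement attains the quantum Fisher information `H`
(`exists_povm_fisherInfo_eq`); the same applies to `N` copies with `N H`, so the scaled cost equals
`Tr H⁻¹` for every `N ≥ 1`.

The design. `H` depends on the unitaries only through `∑_b ∑_k ⟨T⟩²` over the columns of `U_b`, for
traceless selfadjoint `T`; it suffices that this be near `m tr(T²)/(d+1)`. No randomness is needed.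
The standard basis detects exactly the diagonal part of `T`. A family of `2p` quadratic-phase bases,
with `p` a prime in `(d, 2d]`, detects on average exactly the off-diagonal part divided by `d`
(`sum_diagWeight_phaseMatrix`). About `m/(d+1)` copies of the former and a cyclic repetition of the
latter balance the two parts; rounding errors are absorbed by `ε` above the stated threshold
(`exists_isApproxDesign`). -/

noncomputable section

namespace UnitaryEstimation

/-! ### Tensor products of families of matrices -/

section Tensor

variable {ι : Type} {k : ℕ}

/-- The tensor product `A 0 ⊗ ⋯ ⊗ A (k - 1)` of a family of square matrices. -/
def tensorFam (A : Fin k → Matrix ι ι ℂ) : Matrix (Fin k → ι) (Fin k → ι) ℂ :=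
  Matrix.of fun x y => ∏ s, A s (x s) (y s)

theorem tensorFam_apply (A : Fin k → Matrix ι ι ℂ) (x y : Fin k → ι) :
    tensorFam A x y = ∏ s, A s (x s) (y s) := rfl

theorem tensorPow_eq_tensorFam (A : Matrix ι ι ℂ) : tensorPow k A = tensorFam fun _ => A := rfl

theorem tensorFam_update_apply (A : Fin k → Matrix ι ι ℂ) (s : Fin k) (B : Matrix ι ι ℂ)
    (x y : Fin k → ι) :
    tensorFam (Function.update A s B) x y =
      B (x s) (y s) * ∏ r ∈ Finset.univ.erase s, A r (x r) (y r) := by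
  rw [tensorFam_apply, ← Finset.mul_prod_erase _ _ (Finset.mem_univ s), Function.update_self]
  congr 1
  refine Finset.prod_congr rfl fun r hr => ?_
  rw [Function.update_of_ne (Finset.ne_of_mem_erase hr)]

theorem tensorFam_update_sub (A : Fin k → Matrix ι ι ℂ) (s : Fin k) (B C : Matrix ι ι ℂ) :
    tensorFam (Function.update A s (B - C)) =
      tensorFam (Function.update A s B) - tensorFam (Function.update A s C) := by
  ext x y
  simp only [Matrix.sub_apply, tensorFam_update_apply, sub_mul]

theorem tensorFam_update_smul (A : Fin k → Matrix ι ι ℂ) (s : Fin k) (c : ℂ) (B : Matrix ι ι ℂ) :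
    tensorFam (Function.update A s (c • B)) = c • tensorFam (Function.update A s B) := by
  ext x y
  simp only [Matrix.smul_apply, tensorFam_update_apply, smul_eq_mul, mul_assoc]

theorem tensorFam_update_sum {κ : Type*} (S : Finset κ) (A : Fin k → Matrix ι ι ℂ) (s : Fin k)
    (B : κ → Matrix ι ι ℂ) :
    tensorFam (Function.update A s (∑ i ∈ S, B i)) =
      ∑ i ∈ S, tensorFam (Function.update A s (B i)) := by
  ext x y
  simp only [Matrix.sum_apply, tensorFam_update_apply, Finset.sum_mul]

theorem conjTranspose_tensorFam (A : Fin k → Matrix ι ι ℂ) :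
    (tensorFam A)ᴴ = tensorFam fun s => (A s)ᴴ := by
  ext x y
  simp [tensorFam_apply, Matrix.conjTranspose_apply]

section

variable [DecidableEq ι]

theorem tensorFam_one : tensorFam (fun _ : Fin k => (1 : Matrix ι ι ℂ)) = 1 := by
  ext x y
  simp only [tensorFam_apply, Matrix.one_apply, Fintype.prod_ite_zero, Finset.prod_const_one,
    funext_iff]

/-- The operator `1 ⊗ ⋯ ⊗ A ⊗ ⋯ ⊗ 1` with `A` acting on the factor `s`. -/
def siteOp (s : Fin k) (A : Matrix ι ι ℂ) : Matrix (Fin k → ι) (Fin k → ι) ℂ :=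
  tensorFam (Function.update (fun _ => 1) s A)

/-- The collective operator `∑ s, 1 ⊗ ⋯ ⊗ A ⊗ ⋯ ⊗ 1`. -/
def siteSum (k : ℕ) (A : Matrix ι ι ℂ) : Matrix (Fin k → ι) (Fin k → ι) ℂ :=
  ∑ s, siteOp s A

theorem siteSum_sum_smul {κ : Type*} (S : Finset κ) (c : κ → ℂ) (A : κ → Matrix ι ι ℂ) :
    siteSum k (∑ i ∈ S, c i • A i) = ∑ i ∈ S, c i • siteSum k (A i) := by
  simp only [siteSum, siteOp, tensorFam_update_sum, tensorFam_update_smul, Finset.smul_sum]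
  exact Finset.sum_comm

theorem siteOp_isHermitian (s : Fin k) {A : Matrix ι ι ℂ} (hA : A.IsHermitian) :
    (siteOp s A).IsHermitian := by
  unfold Matrix.IsHermitian siteOp
  rw [conjTranspose_tensorFam]
  congr 1
  funext r
  by_cases h : r = s
  · subst h; simpa using hA.eq
  · simp [Function.update_of_ne h]

theorem siteSum_isHermitian {A : Matrix ι ι ℂ} (hA : A.IsHermitian) :
    (siteSum k A).IsHermitian := by
  unfold Matrix.IsHermitian siteSum
  rw [Matrix.conjTranspose_sum]
  exact Finset.sum_congr rfl fun s _ => siteOp_isHermitian s hA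

end

variable [Fintype ι]

theorem tensorFam_mul (A B : Fin k → Matrix ι ι ℂ) :
    tensorFam A * tensorFam B = tensorFam fun s => A s * B s := by
  ext x y
  simp only [Matrix.mul_apply, tensorFam_apply, ← Finset.prod_mul_distrib]
  rw [Finset.prod_univ_sum, Fintype.piFinset_univ]

theorem trace_tensorFam (A : Fin k → Matrix ι ι ℂ) :
    (tensorFam A).trace = ∏ s, (A s).trace := by
  simp only [Matrix.trace, Matrix.diag_apply, tensorFam_apply]
  rw [Finset.prod_univ_sum, Fintype.piFinset_univ]

theorem trace_tensorPow {ρ : Matrix ι ι ℂ} (hρ : ρ.trace = 1) : (tensorPow k ρ).trace = 1 := by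
  rw [tensorPow_eq_tensorFam, trace_tensorFam]; simp [hρ]

variable [DecidableEq ι]

theorem siteOp_mul_tensorPow (s : Fin k) (A B : Matrix ι ι ℂ) :
    siteOp s A * tensorPow k B = tensorFam (Function.update (fun _ => B) s (A * B)) := by
  rw [tensorPow_eq_tensorFam, siteOp, tensorFam_mul]
  congr 1
  funext r
  by_cases h : r = s
  · subst h; simp
  · simp [Function.update_of_ne h]

theorem tensorPow_mul_siteOp (s : Fin k) (A B : Matrix ι ι ℂ) :
    tensorPow k B * siteOp s A = tensorFam (Function.update (fun _ => B) s (B * A)) := by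
  rw [tensorPow_eq_tensorFam, siteOp, tensorFam_mul]
  congr 1
  funext r
  by_cases h : r = s
  · subst h; simp
  · simp [Function.update_of_ne h]

theorem tensorPow_conjTranspose_mul_self {A : Matrix ι ι ℂ} (hA : Aᴴ * A = 1) :
    (tensorPow k A)ᴴ * tensorPow k A = 1 := by
  rw [tensorPow_eq_tensorFam, conjTranspose_tensorFam, tensorFam_mul]
  simp only [hA, tensorFam_one]

theorem trace_tensorPow_mul_siteOp {ρ : Matrix ι ι ℂ} (hρ : ρ.trace = 1) (s : Fin k)
    (A : Matrix ι ι ℂ) : (tensorPow k ρ * siteOp s A).trace = (ρ * A).trace := by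
  rw [tensorPow_mul_siteOp, trace_tensorFam, Finset.prod_eq_single s]
  · simp
  · intro r _ hr
    simp [Function.update_of_ne hr, hρ]
  · simp

theorem trace_tensorPow_mul_siteOp_mul_siteOp {ρ : Matrix ι ι ℂ} (hρ : ρ.trace = 1)
    (s r : Fin k) (A B : Matrix ι ι ℂ) :
    (tensorPow k ρ * (siteOp s A * siteOp r B)).trace =
      if s = r then (ρ * (A * B)).trace else (ρ * A).trace * (ρ * B).trace := by
  rw [tensorPow_eq_tensorFam, siteOp, siteOp, tensorFam_mul, tensorFam_mul, trace_tensorFam]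
  split_ifs with h
  · subst h
    rw [Finset.prod_eq_single s]
    · simp
    · intro q _ hq
      simp [Function.update_of_ne hq, hρ]
    · simp
  · rw [Finset.prod_eq_mul s r h]
    · simp [Function.update_of_ne h, Function.update_of_ne (Ne.symm h)]
    · intro q _ hq
      simp [Function.update_of_ne hq.1, Function.update_of_ne hq.2, hρ]
    · simp
    · simp

theorem trace_tensorPow_mul_siteSum {ρ : Matrix ι ι ℂ} (hρ : ρ.trace = 1) (A : Matrix ι ι ℂ) :
    (tensorPow k ρ * siteSum k A).trace = k * (ρ * A).trace := by
  simp [siteSum, Matrix.mul_sum, Matrix.trace_sum, trace_tensorPow_mul_siteOp hρ]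

/-- The `k` coinciding pairs of sites give the second moment, and the `k(k-1)` distinct pairs
factorize. With `k` the number of copies and centred operators only the linear term survives; with
`k = n` the pair term carries the quadratic scaling. -/
theorem trace_tensorPow_mul_siteSum_mul_siteSum {ρ : Matrix ι ι ℂ} (hρ : ρ.trace = 1)
    (A B : Matrix ι ι ℂ) :
    (tensorPow k ρ * (siteSum k A * siteSum k B)).trace =
      k * (ρ * (A * B)).trace + k * (k - 1) * ((ρ * A).trace * (ρ * B).trace) := by
  simp only [siteSum, Matrix.mul_sum, Matrix.sum_mul, Matrix.trace_sum,
    trace_tensorPow_mul_siteOp_mul_siteOp hρ]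
  have h : ∀ s : Fin k, ∀ a b : ℂ, ∑ r, (if r = s then a else b) = a + (k - 1) * b := by
    intro s a b
    have : ∀ r : Fin k, (if r = s then a else b) = (if r = s then a - b else 0) + b := by
      intro r; split_ifs <;> ring
    simp only [this, Finset.sum_add_distrib, Finset.sum_ite_eq', Finset.mem_univ, if_true,
      Finset.sum_const, Finset.card_univ, Fintype.card_fin, nsmul_eq_mul]
    ring
  simp only [h, Finset.sum_const, Finset.card_univ, Fintype.card_fin, nsmul_eq_mul]
  ring

end Tensor

/-! ### Differentiation of matrix valued curves -/

section Deriv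

/-- Entrywise derivative at `0` of a matrix valued curve. -/
def HasMatrixDeriv {ι κ : Type} (F : ℝ → Matrix ι κ ℂ) (F' : Matrix ι κ ℂ) : Prop :=
  ∀ i j, HasDerivAt (fun t => F t i j) (F' i j) 0

variable {ι κ μ : Type}

theorem HasMatrixDeriv.unique {F : ℝ → Matrix ι κ ℂ} {F' F'' : Matrix ι κ ℂ}
    (h : HasMatrixDeriv F F') (h' : HasMatrixDeriv F F'') : F' = F'' := by
  ext i j
  exact (h i j).unique (h' i j)

theorem HasMatrixDeriv.const (A : Matrix ι κ ℂ) : HasMatrixDeriv (fun _ => A) 0 :=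
  fun i j => hasDerivAt_const 0 (A i j)

theorem HasMatrixDeriv.mul [Fintype κ] {F : ℝ → Matrix ι κ ℂ} {F' : Matrix ι κ ℂ}
    {G : ℝ → Matrix κ μ ℂ} {G' : Matrix κ μ ℂ} (hF : HasMatrixDeriv F F')
    (hG : HasMatrixDeriv G G') :
    HasMatrixDeriv (fun t => F t * G t) (F' * G 0 + F 0 * G') := by
  intro i j
  simp only [Matrix.mul_apply, Matrix.add_apply, ← Finset.sum_add_distrib]
  exact HasDerivAt.fun_sum fun l _ => (hF i l).mul (hG l j)

theorem HasMatrixDeriv.conjTranspose {F : ℝ → Matrix ι κ ℂ} {F' : Matrix ι κ ℂ}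
    (hF : HasMatrixDeriv F F') : HasMatrixDeriv (fun t => (F t)ᴴ) F'ᴴ :=
  fun i j => (hF j i).star

theorem HasMatrixDeriv.one_kronecker [DecidableEq μ] {F : ℝ → Matrix ι κ ℂ} {F' : Matrix ι κ ℂ}
    (hF : HasMatrixDeriv F F') :
    HasMatrixDeriv (fun t => (1 : Matrix μ μ ℂ) ⊗ₖ F t) ((1 : Matrix μ μ ℂ) ⊗ₖ F') := by
  intro i j
  simp only [Matrix.kroneckerMap_apply]
  exact (hF i.2 j.2).const_mul _

theorem HasMatrixDeriv.tensorPow {F : ℝ → Matrix ι ι ℂ} {F' : Matrix ι ι ℂ} {k : ℕ}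
    (hF : HasMatrixDeriv F F') :
    HasMatrixDeriv (fun t => tensorPow k (F t))
      (∑ s, tensorFam (Function.update (fun _ => F 0) s F')) := by
  intro x y
  have h := HasDerivAt.fun_finsetProd (u := (Finset.univ : Finset (Fin k)))
    (f := fun s t => F t (x s) (y s)) (f' := fun s => F' (x s) (y s)) (x := (0 : ℝ))
    (fun s _ => hF (x s) (y s))
  convert! h using 1
  simp only [Matrix.sum_apply, tensorFam_update_apply, smul_eq_mul, mul_comm]

theorem HasMatrixDeriv.congr_of_eventuallyEq {F G : ℝ → Matrix ι κ ℂ} {F' : Matrix ι κ ℂ}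
    (hF : HasMatrixDeriv F F') (h : ∀ᶠ t in 𝓝 0, G t = F t) : HasMatrixDeriv G F' := by
  intro i j
  refine (hF i j).congr_of_eventuallyEq ?_
  filter_upwards [h] with t ht
  rw [ht]

/-- The derivative of the determinant at the identity is the trace. -/
theorem HasMatrixDeriv.det [Fintype ι] [DecidableEq ι] {F : ℝ → Matrix ι ι ℂ} {F' : Matrix ι ι ℂ}
    (hF : HasMatrixDeriv F F') (h0 : F 0 = 1) : HasDerivAt (fun t => (F t).det) F'.trace 0 := by
  simp only [Matrix.det_apply]
  have h := HasDerivAt.fun_sum (u := (Finset.univ : Finset (Equiv.Perm ι)))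
    (A := fun σ t => Equiv.Perm.sign σ • ∏ i, F t (σ i) i)
    (A' := fun σ => Equiv.Perm.sign σ •
      ∑ i, (∏ j ∈ Finset.univ.erase i, F 0 (σ j) j) • F' (σ i) i) (x := (0 : ℝ))
    (fun σ _ => (HasDerivAt.fun_finsetProd (fun i _ => hF (σ i) i)).const_smul _)
  convert! h using 1
  rw [Finset.sum_eq_single 1]
  · simp only [h0, Equiv.Perm.sign_one, one_smul, Equiv.Perm.one_apply, Matrix.one_apply_eq,
      Finset.prod_const_one]
    rfl
  · intro σ _ hσ
    rw [Finset.sum_eq_zero, smul_zero]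
    intro i _
    -- A nontrivial permutation moves at least two points, so after one factor is differentiated an
    -- off-diagonal entry of the identity still remains.
    obtain ⟨j, hj⟩ : ∃ j, σ j ≠ j := by
      by_contra! hc
      exact hσ (Equiv.ext hc)
    obtain ⟨l, hl, hli⟩ : ∃ l, σ l ≠ l ∧ l ≠ i := by
      by_cases hji : j = i
      · refine ⟨σ j, fun h => hj (σ.injective h), fun h => hj (h.trans hji.symm)⟩
      · exact ⟨j, hj, hji⟩
    rw [Finset.prod_eq_zero (Finset.mem_erase.2 ⟨hli, Finset.mem_univ l⟩), zero_smul]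
    rw [h0, Matrix.one_apply_ne hl]
  · simp

variable {p : ℕ}

theorem partialDeriv_eq {F : (Fin p → ℝ) → Matrix ι ι ℂ} {θ : Fin p → ℝ} {α : Fin p}
    {F' : Matrix ι ι ℂ}
    (h : HasMatrixDeriv (fun t : ℝ => F (θ + t • (Pi.single α 1 : Fin p → ℝ))) F') :
    partialDeriv F θ α = F' := by
  ext i j
  have hij : HasLineDerivAt ℝ (fun η => F η i j) (F' i j) θ (Pi.single α 1) := h i j
  exact hij.lineDeriv

theorem hasMatrixDeriv_partialDeriv {F : (Fin p → ℝ) → Matrix ι ι ℂ} {θ : Fin p → ℝ}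
    (h : ∀ i j, DifferentiableAt ℝ (fun η => F η i j) θ) (α : Fin p) :
    HasMatrixDeriv (fun t : ℝ => F (θ + t • (Pi.single α 1 : Fin p → ℝ))) (partialDeriv F θ α) :=
  fun i j => ((h i j).lineDifferentiableAt (v := Pi.single α 1)).hasLineDerivAt

end Deriv

/-! ### Generators of a normalized parametrization -/

/-- The matrices `t α` form an orthonormal basis of the traceless selfadjoint matrices. -/
structure IsTracelessBasis {d : ℕ} (t : Fin (d ^ 2 - 1) → Matrix (Fin d) (Fin d) ℂ) : Prop where
  isHermitian : ∀ α, (t α).IsHermitian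
  trace_eq_zero : ∀ α, (t α).trace = 0
  trace_mul : ∀ α β, (t α * t β).trace = if α = β then 1 else 0

section Parametrization

variable {d : ℕ} {Θ : Set (Fin (d ^ 2 - 1) → ℝ)}
  {V : (Fin (d ^ 2 - 1) → ℝ) → Matrix (Fin d) (Fin d) ℂ} {θ : Fin (d ^ 2 - 1) → ℝ}

theorem IsNormalizedParametrization.conjTranspose_mul_self
    (h : IsNormalizedParametrization Θ V θ) {η : Fin (d ^ 2 - 1) → ℝ} (hη : η ∈ Θ) :
    (V η)ᴴ * V η = 1 :=
  Matrix.mem_unitaryGroup_iff'.1 (Matrix.mem_specialUnitaryGroup_iff.1 (h.special_unitary η hη)).1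

theorem IsNormalizedParametrization.partialDeriv_eq (h : IsNormalizedParametrization Θ V θ)
    (α : Fin (d ^ 2 - 1)) :
    partialDeriv V θ α = (-Complex.I) • (V θ * generator V θ α) := by
  have hV := mul_eq_one_comm.1 (h.conjTranspose_mul_self h.mem)
  rw [generator, Matrix.mul_smul, smul_smul, ← Matrix.mul_assoc, hV, Matrix.one_mul]
  simp

theorem IsNormalizedParametrization.eventually_mem (h : IsNormalizedParametrization Θ V θ)
    (α : Fin (d ^ 2 - 1)) :
    ∀ᶠ t : ℝ in 𝓝 0, θ + t • (Pi.single α 1 : Fin (d ^ 2 - 1) → ℝ) ∈ Θ := by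
  have hc : ContinuousAt (fun t : ℝ => θ + t • (Pi.single α 1 : Fin (d ^ 2 - 1) → ℝ)) 0 := by
    fun_prop
  exact hc.eventually_mem (h.isOpen.mem_nhds (by simpa using h.mem))

theorem IsNormalizedParametrization.hasMatrixDeriv (h : IsNormalizedParametrization Θ V θ)
    (α : Fin (d ^ 2 - 1)) :
    HasMatrixDeriv (fun t : ℝ => V (θ + t • (Pi.single α 1 : Fin (d ^ 2 - 1) → ℝ)))
      ((-Complex.I) • (V θ * generator V θ α)) :=
  h.partialDeriv_eq α ▸ hasMatrixDeriv_partialDeriv h.differentiableAt α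

theorem IsNormalizedParametrization.isTracelessBasis (h : IsNormalizedParametrization Θ V θ) :
    IsTracelessBasis (generator V θ) where
  isHermitian α := by
    -- Differentiating `V†V = 1`, valid near `θ` because `Θ` is open, gives selfadjointness.
    have h1 := (h.hasMatrixDeriv α).conjTranspose.mul (h.hasMatrixDeriv α)
    have h2 := (HasMatrixDeriv.const (1 : Matrix (Fin d) (Fin d) ℂ)).congr_of_eventuallyEq
      (G := fun t : ℝ => (V (θ + t • (Pi.single α 1 : Fin (d ^ 2 - 1) → ℝ)))ᴴ *
        V (θ + t • (Pi.single α 1 : Fin (d ^ 2 - 1) → ℝ))) (by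
        filter_upwards [h.eventually_mem α] with t ht
        exact h.conjTranspose_mul_self ht)
    have h3 := h1.unique h2
    have hV := h.conjTranspose_mul_self h.mem
    simp only [zero_smul, add_zero, Matrix.conjTranspose_smul, Matrix.conjTranspose_mul,
      Matrix.smul_mul, Matrix.mul_smul, Matrix.mul_assoc, hV, Matrix.mul_one] at h3
    rw [← Matrix.mul_assoc, hV, Matrix.one_mul] at h3
    simp only [star_neg, RCLike.star_def, Complex.conj_I, neg_neg, neg_smul,
      ← sub_eq_add_neg, ← smul_sub] at h3
    exact sub_eq_zero.1 ((smul_eq_zero.1 h3).resolve_left Complex.I_ne_zero)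
  trace_eq_zero α := by
    have hV := h.conjTranspose_mul_self h.mem
    -- Multiplying by `V(θ)†` moves the curve to the identity, where the derivative of the constant
    -- determinant is the trace.
    have h1 := (HasMatrixDeriv.const (V θ)ᴴ).mul (h.hasMatrixDeriv α)
    have h2 := h1.det (by simpa using hV)
    have h3 : HasDerivAt (fun t : ℝ =>
        ((V θ)ᴴ * V (θ + t • (Pi.single α 1 : Fin (d ^ 2 - 1) → ℝ))).det) 0 0 := by
      refine (hasDerivAt_const (0 : ℝ) (1 : ℂ)).congr_of_eventuallyEq ?_
      filter_upwards [h.eventually_mem α] with t ht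
      rw [Matrix.det_mul, Matrix.det_conjTranspose,
        (Matrix.mem_specialUnitaryGroup_iff.1 (h.special_unitary _ h.mem)).2,
        (Matrix.mem_specialUnitaryGroup_iff.1 (h.special_unitary _ ht)).2]
      simp
    have h4 := h2.unique h3
    rw [Matrix.zero_mul, zero_add, Matrix.mul_smul, ← Matrix.mul_assoc, hV, Matrix.one_mul,
      Matrix.trace_smul, smul_eq_mul] at h4
    simpa using h4
  trace_mul := h.normalized

end Parametrization

/-! ### Completeness relation for the generators. -/

section Completeness

variable {d : ℕ} {t : Fin (d ^ 2 - 1) → Matrix (Fin d) (Fin d) ℂ}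

/-- The completeness relation of the basis `t α`, `1 / √d` of the `d × d` matrices. -/
theorem IsTracelessBasis.sum_mul_apply (ht : IsTracelessBasis t) (hd : 0 < d)
    (i j k l : Fin d) :
    ∑ α, t α i j * t α k l =
      (if i = l ∧ j = k then 1 else 0) - (if i = j ∧ k = l then (1 / d : ℂ) else 0) := by
  have hd0 : (d : ℂ) ≠ 0 := by exact_mod_cast hd.ne'
  -- The rows of `Q` are the vectorized `1/√d` and `t_α`; orthonormality is `Q R = 1`. Both index
  -- sets have `d²` elements, so `R Q = 1` as well, which is completeness.
  let Q : Matrix (Option (Fin (d ^ 2 - 1))) (Fin d × Fin d) ℂ :=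
    Matrix.of fun a x => a.elim (((1 / Real.sqrt d : ℝ) : ℂ) * (1 : Matrix (Fin d) (Fin d) ℂ) x.1 x.2)
      fun α => t α x.1 x.2
  let R : Matrix (Fin d × Fin d) (Option (Fin (d ^ 2 - 1))) ℂ :=
    Matrix.of fun x a => a.elim (((1 / Real.sqrt d : ℝ) : ℂ) * (1 : Matrix (Fin d) (Fin d) ℂ) x.2 x.1)
      fun α => t α x.2 x.1
  have hs : (((1 / Real.sqrt d : ℝ) : ℂ)) * (((1 / Real.sqrt d : ℝ) : ℂ)) = 1 / d := by
    rw [← Complex.ofReal_mul, div_mul_div_comm, Real.mul_self_sqrt (by positivity)]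
    simp
  have hmul : ∀ A B : Matrix (Fin d) (Fin d) ℂ,
      ∑ x : Fin d × Fin d, A x.1 x.2 * B x.2 x.1 = (A * B).trace := by
    intro A B
    simp only [Matrix.trace, Matrix.diag_apply, Matrix.mul_apply, Fintype.sum_prod_type]
  have hQR : Q * R = 1 := by
    ext a b
    rw [Matrix.mul_apply]
    rcases a with _ | α <;> rcases b with _ | β
    · simp only [Q, R, Matrix.of_apply, Option.elim, Matrix.one_apply_eq]
      have := hmul (((1 / Real.sqrt d : ℝ) : ℂ) • 1) (((1 / Real.sqrt d : ℝ) : ℂ) • 1)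
      simp only [Matrix.smul_apply, smul_eq_mul, Matrix.smul_mul, Matrix.mul_smul, Matrix.one_mul,
        smul_smul, hs, Matrix.trace_smul, Matrix.trace_one, Fintype.card_fin] at this
      rw [this, one_div, inv_mul_cancel₀ hd0]
    · simp only [Q, R, Matrix.of_apply, Option.elim]
      have := hmul (((1 / Real.sqrt d : ℝ) : ℂ) • 1) (t β)
      simp only [Matrix.smul_apply, smul_eq_mul, Matrix.smul_mul, Matrix.one_mul,
        Matrix.trace_smul, ht.trace_eq_zero, mul_zero] at this
      rw [this]; simp
    · simp only [Q, R, Matrix.of_apply, Option.elim]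
      have := hmul (t α) (((1 / Real.sqrt d : ℝ) : ℂ) • 1)
      simp only [Matrix.smul_apply, smul_eq_mul, Matrix.mul_smul, Matrix.mul_one,
        Matrix.trace_smul, ht.trace_eq_zero, mul_zero] at this
      rw [this]; simp
    · simp only [Q, R, Matrix.of_apply, Option.elim]
      rw [hmul, ht.trace_mul, Matrix.one_apply]
      simp
  have hcard : Fintype.card (Option (Fin (d ^ 2 - 1))) = Fintype.card (Fin d × Fin d) := by
    simp only [Fintype.card_option, Fintype.card_fin, Fintype.card_prod]
    have : 0 < d ^ 2 := by positivity
    rw [sq] at *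
    omega
  have hRQ := (Matrix.mul_eq_one_comm_of_equiv (Fintype.equivOfCardEq hcard)).1 hQR
  have := congrFun (congrFun hRQ (j, i)) (k, l)
  rw [Matrix.mul_apply, Fintype.sum_option] at this
  simp only [Q, R, Matrix.of_apply, Option.elim] at this
  have h1 : (if i = j ∧ k = l then (1 / d : ℂ) else 0) =
      ((1 / Real.sqrt d : ℝ) : ℂ) * (if i = j then 1 else 0) *
        (((1 / Real.sqrt d : ℝ) : ℂ) * (if k = l then 1 else 0)) := by
    rw [mul_mul_mul_comm, hs]
    by_cases h1 : i = j <;> by_cases h2 : k = l <;> simp [h1, h2]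
  rw [eq_sub_iff_add_eq', h1]
  simp only [Matrix.one_apply, Prod.mk.injEq] at this
  rw [this]
  simp only [and_comm]

end Completeness

/-! ### Derivatives of the output states -/

section Output

variable {d n : ℕ} {Θ : Set (Fin (d ^ 2 - 1) → ℝ)}
  {V : (Fin (d ^ 2 - 1) → ℝ) → Matrix (Fin d) (Fin d) ℂ} {θ : Fin (d ^ 2 - 1) → ℝ}
  {A : Type} [DecidableEq A]

/-- The family `ρ` is generated at `θ` by the selfadjoint operators `K α`:
`∂_α ρ = -i [K_α, ρ]`. -/
structure IsGeneratedBy {ι : Type} [Fintype ι] {p : ℕ} (ρ : (Fin p → ℝ) → Matrix ι ι ℂ)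
    (θ : Fin p → ℝ) (K : Fin p → Matrix ι ι ℂ) : Prop where
  isHermitian : ∀ α, (K α).IsHermitian
  hasMatrixDeriv : ∀ α, HasMatrixDeriv (fun t : ℝ => ρ (θ + t • (Pi.single α 1 : Fin p → ℝ)))
    ((-Complex.I) • (K α * ρ θ - ρ θ * K α))

theorem IsGeneratedBy.partialDeriv_eq {ι : Type} [Fintype ι] {p : ℕ}
    {ρ : (Fin p → ℝ) → Matrix ι ι ℂ} {θ : Fin p → ℝ} {K : Fin p → Matrix ι ι ℂ}
    (h : IsGeneratedBy ρ θ K) (α : Fin p) :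
    partialDeriv ρ θ α = (-Complex.I) • (K α * ρ θ - ρ θ * K α) :=
  UnitaryEstimation.partialDeriv_eq (h.hasMatrixDeriv α)

theorem IsGeneratedBy.tensorPow {ι : Type} [Fintype ι] [DecidableEq ι] {p : ℕ}
    {ρ : (Fin p → ℝ) → Matrix ι ι ℂ} {θ : Fin p → ℝ} {K : Fin p → Matrix ι ι ℂ}
    (h : IsGeneratedBy ρ θ K) (N : ℕ) :
    IsGeneratedBy (fun η => tensorPow N (ρ η)) θ (fun α => siteSum N (K α)) where
  isHermitian α := siteSum_isHermitian (h.isHermitian α)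
  hasMatrixDeriv α := by
    have h1 := (h.hasMatrixDeriv α).tensorPow (k := N)
    convert! h1 using 1
    simp only [zero_smul, add_zero, tensorFam_update_smul, tensorFam_update_sub, siteSum,
      Matrix.sum_mul, Matrix.mul_sum, siteOp_mul_tensorPow, tensorPow_mul_siteOp,
      ← Finset.smul_sum, Finset.sum_sub_distrib]

/-- Scalars drop out of the commutator, so the generators can be centred at no cost. -/
theorem IsGeneratedBy.sub_smul_one {ι : Type} [Fintype ι] [DecidableEq ι] {p : ℕ}
    {ρ : (Fin p → ℝ) → Matrix ι ι ℂ} {θ : Fin p → ℝ} {K : Fin p → Matrix ι ι ℂ}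
    (h : IsGeneratedBy ρ θ K) (c : Fin p → ℝ) :
    IsGeneratedBy ρ θ (fun α => K α - ((c α : ℝ) : ℂ) • 1) where
  isHermitian α := by
    refine (h.isHermitian α).sub ?_
    simp [Matrix.IsHermitian, Matrix.conjTranspose_smul]
  hasMatrixDeriv α := by
    simpa [Matrix.sub_mul, Matrix.mul_sub] using h.hasMatrixDeriv α

/-- The unitary `1_A ⊗ V^{⊗n}`. -/
def outputUnitary (A : Type) [DecidableEq A] (n : ℕ) (V : Matrix (Fin d) (Fin d) ℂ) :
    Matrix (A × (Fin n → Fin d)) (A × (Fin n → Fin d)) ℂ :=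
  (1 : Matrix A A ℂ) ⊗ₖ tensorPow n V

/-- The generator `1_A ⊗ ∑ s, 1 ⊗ ⋯ ⊗ t ⊗ ⋯ ⊗ 1`. -/
def collective (A : Type) [DecidableEq A] (n : ℕ) (t : Matrix (Fin d) (Fin d) ℂ) :
    Matrix (A × (Fin n → Fin d)) (A × (Fin n → Fin d)) ℂ :=
  (1 : Matrix A A ℂ) ⊗ₖ siteSum n t

theorem collective_isHermitian {t : Matrix (Fin d) (Fin d) ℂ} (ht : t.IsHermitian) :
    (collective A n t).IsHermitian := by
  unfold Matrix.IsHermitian collective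
  rw [Matrix.conjTranspose_kronecker, Matrix.conjTranspose_one, (siteSum_isHermitian ht).eq]

variable [Fintype A]

theorem outputUnitary_conjTranspose_mul_self {V : Matrix (Fin d) (Fin d) ℂ} (hV : Vᴴ * V = 1) :
    (outputUnitary A n V)ᴴ * outputUnitary A n V = 1 := by
  rw [outputUnitary, Matrix.conjTranspose_kronecker, ← Matrix.mul_kronecker_mul,
    tensorPow_conjTranspose_mul_self hV]
  simp

theorem IsNormalizedParametrization.isGeneratedBy_outputState
    (h : IsNormalizedParametrization Θ V θ)
    (ω : Matrix (A × (Fin n → Fin d)) (A × (Fin n → Fin d)) ℂ) :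
    IsGeneratedBy (outputState V ω) θ (fun α => outputUnitary A n (V θ) *
      collective A n (generator V θ α) * (outputUnitary A n (V θ))ᴴ) where
  isHermitian α := by
    unfold Matrix.IsHermitian
    rw [Matrix.conjTranspose_mul, Matrix.conjTranspose_mul, Matrix.conjTranspose_conjTranspose,
      (collective_isHermitian (h.isTracelessBasis.isHermitian α)).eq, Matrix.mul_assoc]
  hasMatrixDeriv α := by
    set W := outputUnitary A n (V θ) with hW
    set T := collective A n (generator V θ α) with hT
    have hWW : Wᴴ * W = 1 := outputUnitary_conjTranspose_mul_self (h.conjTranspose_mul_self h.mem)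
    have hTT : Tᴴ = T := (collective_isHermitian (h.isTracelessBasis.isHermitian α)).eq
    have h1 : HasMatrixDeriv
        (fun t : ℝ => outputUnitary A n (V (θ + t • (Pi.single α 1 : Fin (d ^ 2 - 1) → ℝ))))
        ((-Complex.I) • (W * T)) := by
      have h2 := ((h.hasMatrixDeriv α).tensorPow (k := n)).one_kronecker (μ := A)
      convert! h2 using 1
      simp only [zero_smul, add_zero, tensorFam_update_smul, ← tensorPow_mul_siteOp,
        ← Finset.smul_sum, ← Matrix.mul_sum]
      rw [hW, hT, outputUnitary, collective, ← Matrix.mul_kronecker_mul, Matrix.one_mul,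
        Matrix.kronecker_smul]
      rfl
    have h3 := (h1.mul (HasMatrixDeriv.const ω)).mul h1.conjTranspose
    convert! h3 using 1
    simp only [zero_smul, add_zero, Matrix.mul_zero, Matrix.conjTranspose_smul,
      Matrix.conjTranspose_mul, hTT, outputState]
    change -Complex.I • (W * T * Wᴴ * (W * ω * Wᴴ) - W * ω * Wᴴ * (W * T * Wᴴ)) = _
    have e1 : W * T * Wᴴ * (W * ω * Wᴴ) = W * T * (Wᴴ * W) * ω * Wᴴ := by
      simp only [Matrix.mul_assoc]
    have e2 : W * ω * Wᴴ * (W * T * Wᴴ) = W * ω * (Wᴴ * W) * T * Wᴴ := by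
      simp only [Matrix.mul_assoc]
    rw [e1, e2, hWW, Matrix.mul_one, Matrix.mul_one, smul_sub, sub_eq_add_neg]
    simp only [← hW, Matrix.smul_mul, Matrix.neg_mul, Matrix.mul_smul, Matrix.mul_assoc, star_neg, RCLike.star_def,
      Complex.conj_I, neg_neg, neg_smul]

end Output

/-! ### Upper bounds on the Fisher information of measurements -/

section Fisher

variable {ι : Type} [Fintype ι] [DecidableEq ι] {p : ℕ}

theorem trace_mul_nonneg {A B : Matrix ι ι ℂ} (hA : A.PosSemidef) (hB : B.PosSemidef) :
    0 ≤ (A * B).trace := by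
  obtain ⟨C, rfl⟩ : ∃ C : Matrix ι ι ℂ, B = Cᴴ * C := by
    open scoped MatrixOrder in
    exact CStarAlgebra.nonneg_iff_eq_star_mul_self.1 (Matrix.nonneg_iff_posSemidef.2 hB)
  rw [← Matrix.mul_assoc, Matrix.trace_mul_comm, ← Matrix.mul_assoc]
  exact (hA.mul_mul_conjTranspose_same C).trace_nonneg

/-- The Cauchy–Schwarz inequality behind the quantum Cramér–Rao bound. -/
theorem sq_trace_commutator_mul_le {ρ K M : Matrix ι ι ℂ} (hρ : ρ.PosSemidef)
    (hK : K.IsHermitian) (hM : M.PosSemidef) :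
    ((((-Complex.I) • (K * ρ - ρ * K)) * M).trace.re) ^ 2 ≤
      4 * (ρ * M).trace.re * (K * ρ * K * M).trace.re := by
  -- Positivity of `tr[(1 + ixK) ρ (1 + ixK)† M]` for all real `x` makes this quadratic nonnegative;
  -- the claim is that its discriminant is not positive.
  have h : ∀ x : ℝ, 0 ≤ (K * ρ * K * M).trace.re * (x * x) +
      (-(((-Complex.I) • (K * ρ - ρ * K)) * M).trace.re) * x + (ρ * M).trace.re := by
    intro x
    have h1 := trace_mul_nonneg
      (hρ.mul_mul_conjTranspose_same (1 + ((x : ℂ) * Complex.I) • K)) hM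
    have h2 : (1 + ((x : ℂ) * Complex.I) • K) * ρ * (1 + ((x : ℂ) * Complex.I) • K)ᴴ * M =
        ((x * x : ℝ) : ℂ) • (K * ρ * K * M) -
          (x : ℂ) • (((-Complex.I) • (K * ρ - ρ * K)) * M) + ρ * M := by
      have hx : star ((x : ℂ) * Complex.I) = -((x : ℂ) * Complex.I) := by simp
      rw [Matrix.conjTranspose_add, Matrix.conjTranspose_one, Matrix.conjTranspose_smul, hK.eq, hx]
      simp only [Matrix.add_mul, Matrix.mul_add, Matrix.one_mul, Matrix.mul_one, Matrix.smul_mul,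
        Matrix.mul_smul, Matrix.sub_mul, smul_smul, smul_sub, smul_add]
      have hI : -((x : ℂ) * Complex.I) * ((x : ℂ) * Complex.I) = ((x * x : ℝ) : ℂ) := by
        push_cast
        linear_combination (-(x : ℂ) ^ 2) * Complex.I_mul_I
      rw [hI]
      module
    rw [h2, Matrix.trace_add, Matrix.trace_sub, Matrix.trace_smul, Matrix.trace_smul] at h1
    have h3 := (Complex.le_def.1 h1).1
    simp only [Complex.add_re, Complex.sub_re, smul_eq_mul, Complex.re_ofReal_mul,
      Complex.zero_re] at h3
    linarith
  have := discrim_le_zero h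
  rw [discrim] at this
  linarith

/-- The Fisher information of any measurement is bounded by four times the second moment of the
generators. -/
theorem fisherInfo_quadForm_le {ρ : (Fin p → ℝ) → Matrix ι ι ℂ} {θ : Fin p → ℝ}
    {K : Fin p → Matrix ι ι ℂ} (hρ : (ρ θ).PosSemidef) (hK : IsGeneratedBy ρ θ K) (M : POVM ι)
    (c : Fin p → ℝ) :
    c ⬝ᵥ (fisherInfo ρ θ M *ᵥ c) ≤
      4 * (ρ θ * ((∑ α, (c α : ℂ) • K α) * (∑ α, (c α : ℂ) • K α))).trace.re := by
  classical
  set L := ∑ α, (c α : ℂ) • K α with hL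
  have hLh : L.IsHermitian := by
    unfold Matrix.IsHermitian
    rw [hL, Matrix.conjTranspose_sum]
    refine Finset.sum_congr rfl fun α _ => ?_
    rw [Matrix.conjTranspose_smul, (hK.isHermitian α).eq]
    simp
  have hq : ∀ ξ, 0 ≤ (L * ρ θ * L * M.element ξ).trace.re := by
    intro ξ
    have := trace_mul_nonneg (hρ.mul_mul_conjTranspose_same L) (M.posSemidef ξ)
    rw [hLh.eq] at this
    exact (Complex.le_def.1 this).1
  have hD : ∀ ξ, ∑ α, c α * (partialDeriv ρ θ α * M.element ξ).trace.re =
      (((-Complex.I) • (L * ρ θ - ρ θ * L)) * M.element ξ).trace.re := by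
    intro ξ
    have : (-Complex.I) • (L * ρ θ - ρ θ * L) = ∑ α, (c α : ℂ) • partialDeriv ρ θ α := by
      simp only [hK.partialDeriv_eq, hL, Finset.sum_mul, Finset.mul_sum, Matrix.smul_mul,
        Matrix.mul_smul, ← Finset.sum_sub_distrib, Finset.smul_sum]
      refine Finset.sum_congr rfl fun α _ => ?_
      module
    rw [this, Finset.sum_mul, Matrix.trace_sum, Complex.re_sum]
    refine Finset.sum_congr rfl fun α _ => ?_
    rw [Matrix.smul_mul, Matrix.trace_smul, smul_eq_mul, Complex.re_ofReal_mul]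
  have hsum : ∑ ξ, (L * ρ θ * L * M.element ξ).trace.re = (ρ θ * (L * L)).trace.re := by
    rw [← Complex.re_sum, ← Matrix.trace_sum, ← Finset.mul_sum, M.sum_eq_one, Matrix.mul_one,
      Matrix.mul_assoc, Matrix.trace_mul_comm, Matrix.mul_assoc]
  calc c ⬝ᵥ (fisherInfo ρ θ M *ᵥ c)
      = ∑ ξ with 0 < (ρ θ * M.element ξ).trace.re,
          (∑ α, c α * (partialDeriv ρ θ α * M.element ξ).trace.re) ^ 2 /
            (ρ θ * M.element ξ).trace.re := by
        simp only [dotProduct, Matrix.mulVec, fisherInfo, Matrix.of_apply, Finset.sum_mul,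
          Finset.mul_sum, sq, Finset.sum_div]
        rw [Finset.sum_comm' (t' := Finset.univ) (s' := fun _ => Finset.univ) (by simp)]
        rw [Finset.sum_comm' (t' := Finset.univ) (s' := fun _ => Finset.univ) (by simp)]
        conv_rhs => rw [Finset.sum_comm]
        refine Finset.sum_congr rfl fun α _ => ?_
        conv_rhs => rw [Finset.sum_comm]
        refine Finset.sum_congr rfl fun β _ => ?_
        refine Finset.sum_congr rfl fun ξ _ => ?_
        ring
    _ ≤ ∑ ξ with 0 < (ρ θ * M.element ξ).trace.re, 4 * (L * ρ θ * L * M.element ξ).trace.re := by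
        refine Finset.sum_le_sum fun ξ hξ => ?_
        have hpos := (Finset.mem_filter.1 hξ).2
        rw [div_le_iff₀ hpos, hD]
        have := sq_trace_commutator_mul_le hρ hLh (M.posSemidef ξ)
        linarith
    -- Outcomes of zero probability are put back, at nonnegative cost, so that the elements sum to
    -- the identity.
    _ ≤ ∑ ξ, 4 * (L * ρ θ * L * M.element ξ).trace.re :=
        Finset.sum_le_sum_of_subset_of_nonneg (Finset.filter_subset _ _)
          fun ξ _ _ => mul_nonneg (by norm_num) (hq ξ)
    _ = 4 * (ρ θ * (L * L)).trace.re := by rw [← Finset.mul_sum, hsum]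

theorem posSemidef_tensorPow {ρ : Matrix ι ι ℂ} (hρ : ρ.PosSemidef) (N : ℕ) :
    (tensorPow N ρ).PosSemidef := by
  obtain ⟨C, rfl⟩ : ∃ C : Matrix ι ι ℂ, ρ = Cᴴ * C := by
    open scoped MatrixOrder in
    exact CStarAlgebra.nonneg_iff_eq_star_mul_self.1 (Matrix.nonneg_iff_posSemidef.2 hρ)
  have : tensorPow N (Cᴴ * C) = (tensorPow N C)ᴴ * tensorPow N C := by
    simp only [tensorPow_eq_tensorFam, conjTranspose_tensorFam, tensorFam_mul]
  rw [this]
  exact Matrix.posSemidef_conjTranspose_mul_self _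

/-- For centred generators the Fisher information of a collective measurement on `N` copies is
bounded by `N` times the bound for one copy. -/
theorem fisherInfo_tensorPow_quadForm_le {ρ : (Fin p → ℝ) → Matrix ι ι ℂ} {θ : Fin p → ℝ}
    {K : Fin p → Matrix ι ι ℂ} (hρ : IsDensityMatrix (ρ θ)) (hK : IsGeneratedBy ρ θ K)
    (hK0 : ∀ α, (ρ θ * K α).trace = 0) (N : ℕ) (M : POVM (Fin N → ι)) (c : Fin p → ℝ) :
    c ⬝ᵥ (fisherInfo (fun η => tensorPow N (ρ η)) θ M *ᵥ c) ≤
      4 * N * (ρ θ * ((∑ α, (c α : ℂ) • K α) * (∑ α, (c α : ℂ) • K α))).trace.re := by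
  refine (fisherInfo_quadForm_le (posSemidef_tensorPow hρ.1 N) (hK.tensorPow N) M c).trans ?_
  have h0 : (ρ θ * ∑ α, (c α : ℂ) • K α).trace = 0 := by
    simp [Finset.mul_sum, Matrix.trace_sum, hK0]
  simp only [← siteSum_sum_smul, trace_tensorPow_mul_siteSum_mul_siteSum hρ.2, h0, mul_zero,
    add_zero]
  rw [← Complex.ofReal_natCast, Complex.re_ofReal_mul, mul_assoc]

end Fisher

/-! ### Lower bounds on `Tr I⁻¹` -/

section TraceInv

variable {p : ℕ}

/-- The variational bound `Tr I⁻¹ ≥ 2 Tr X - Tr (X I X)`. -/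
theorem trace_inv_ge {I X : Matrix (Fin p) (Fin p) ℝ} (hI : I.PosDef) (hX : X.IsHermitian) :
    2 * X.trace - (X * I * X).trace ≤ I⁻¹.trace := by
  have hu : IsUnit I.det := (Matrix.isUnit_iff_isUnit_det I).1 hI.isUnit
  -- Completing the square: `Tr (X - I⁻¹) I (X - I⁻¹) ≥ 0`, with equality at `X = I⁻¹`.
  have h := (hI.posSemidef.mul_mul_conjTranspose_same (X - I⁻¹)).trace_nonneg
  rw [(hX.sub hI.isHermitian.inv).eq] at h
  have e : (X - I⁻¹) * I * (X - I⁻¹) = X * I * X - X - X + I⁻¹ := by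
    simp only [Matrix.sub_mul, Matrix.mul_sub, Matrix.nonsing_inv_mul _ hu, Matrix.one_mul,
      Matrix.mul_assoc, Matrix.mul_nonsing_inv _ hu, Matrix.mul_one]
    abel
  rw [e, Matrix.trace_add, Matrix.trace_sub, Matrix.trace_sub] at h
  linarith

theorem trace_mul_mul_eq_sum {I X : Matrix (Fin p) (Fin p) ℝ} (hX : X.IsHermitian) :
    (X * I * X).trace = ∑ j, (fun i => X i j) ⬝ᵥ (I *ᵥ fun i => X i j) := by
  have hXT : ∀ i j, X i j = X j i := fun i j => by simpa using (hX.apply j i)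
  simp only [Matrix.trace, Matrix.diag_apply, Matrix.mul_assoc]
  refine Finset.sum_congr rfl fun j _ => ?_
  rw [Matrix.mul_apply, dotProduct]
  refine Finset.sum_congr rfl fun i _ => ?_
  rw [hXT j i]
  rfl

/-- The variational bound at `X = J⁻¹` yields antitonicity of `Tr I⁻¹` without operator monotonicity
of the inverse. -/
theorem trace_inv_le_of_quadForm_le {I J : Matrix (Fin p) (Fin p) ℝ} (hI : I.PosDef)
    (hJ : J.PosDef) (h : ∀ c : Fin p → ℝ, c ⬝ᵥ (I *ᵥ c) ≤ c ⬝ᵥ (J *ᵥ c)) :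
    J⁻¹.trace ≤ I⁻¹.trace := by
  have hu : IsUnit J.det := (Matrix.isUnit_iff_isUnit_det J).1 hJ.isUnit
  have h1 := trace_inv_ge hI hJ.isHermitian.inv
  have h2 : (J⁻¹ * I * J⁻¹).trace ≤ (J⁻¹ * J * J⁻¹).trace := by
    rw [trace_mul_mul_eq_sum hJ.isHermitian.inv, trace_mul_mul_eq_sum hJ.isHermitian.inv]
    exact Finset.sum_le_sum fun j _ => h _
  rw [Matrix.nonsing_inv_mul _ hu, Matrix.one_mul] at h2
  linarith

/-- The variational bound with the scalar trial matrix `(p/B) 1`. -/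
theorem trace_inv_ge_of_trace_le {I : Matrix (Fin p) (Fin p) ℝ} {B : ℝ} (hI : I.PosDef)
    (hB : 0 < B) (h : I.trace ≤ B) : (p : ℝ) ^ 2 / B ≤ I⁻¹.trace := by
  have h1 := trace_inv_ge hI (X := ((p : ℝ) / B) • 1) (by
    simp [Matrix.IsHermitian])
  simp only [Matrix.trace_smul, Matrix.trace_one, Fintype.card_fin, Matrix.smul_mul,
    Matrix.one_mul, Matrix.mul_smul, Matrix.mul_one, smul_eq_mul] at h1
  have h2 : (p : ℝ) / B * (p / B * I.trace) ≤ p / B * (p / B * B) := by gcongr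
  have h3 : (p : ℝ) / B * (p / B * B) = p ^ 2 / B := by field_simp
  have h4 : 2 * ((p : ℝ) / B * p) = 2 * (p ^ 2 / B) := by ring
  linarith

theorem trace_eq_sum_quadForm (I : Matrix (Fin p) (Fin p) ℝ) :
    I.trace = ∑ j, (Pi.single j (1 : ℝ)) ⬝ᵥ (I *ᵥ Pi.single j 1) := by
  simp [Matrix.trace]

end TraceInv

/-! ### The Casimir bound and the optimality of the cost -/

section Casimir

variable {d n : ℕ} {t : Fin (d ^ 2 - 1) → Matrix (Fin d) (Fin d) ℂ}

/-- The operator exchanging the tensor factors `s` and `r`. -/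
def swapOp (d : ℕ) {n : ℕ} (s r : Fin n) : Matrix (Fin n → Fin d) (Fin n → Fin d) ℂ :=
  Equiv.Perm.permMatrix ℂ (Equiv.arrowCongr (Equiv.swap s r) (Equiv.refl (Fin d)))

theorem ite_mul_ite_zero (P Q : Prop) [Decidable P] [Decidable Q] (a b : ℂ) :
    (if P then a else 0) * (if Q then b else 0) = if P ∧ Q then a * b else 0 := by
  by_cases hP : P <;> by_cases hQ : Q <;> simp [hP, hQ]

theorem swapOp_apply (s r : Fin n) (x y : Fin n → Fin d) :
    swapOp d s r x y = if (∀ q, x (Equiv.swap s r q) = y q) then 1 else 0 := by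
  simp only [swapOp, Equiv.Perm.permMatrix, PEquiv.toMatrix_apply, Equiv.toPEquiv_apply,
    Option.mem_some_iff, funext_iff]
  simp [Equiv.arrowCongr]

theorem swapOp_isHermitian (s r : Fin n) : (swapOp d s r).IsHermitian := by
  unfold Matrix.IsHermitian swapOp
  rw [Matrix.conjTranspose_permMatrix]
  congr 1

theorem swapOp_mul_self (s r : Fin n) : swapOp d s r * swapOp d s r = 1 := by
  rw [swapOp, ← Matrix.permMatrix_mul, ← Matrix.permMatrix_one]
  congr 1
  ext f q
  simp [Equiv.arrowCongr]

/-- A selfadjoint involution is at most `1`, since `(1 - S)†(1 - S) = 2(1 - S)`. It is applied to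
swaps. -/
theorem trace_mul_re_le_of_mul_self_eq_one {ι : Type} [Fintype ι] [DecidableEq ι]
    {ω S : Matrix ι ι ℂ} (hω : ω.PosSemidef) (hS : S.IsHermitian) (hSS : S * S = 1) :
    (ω * S).trace.re ≤ ω.trace.re := by
  have h := trace_mul_nonneg hω (Matrix.posSemidef_conjTranspose_mul_self (1 - S))
  have e : ω * ((1 - S)ᴴ * (1 - S)) = (2 : ℂ) • (ω - ω * S) := by
    rw [Matrix.conjTranspose_sub, hS.eq, Matrix.conjTranspose_one]
    simp only [Matrix.sub_mul, Matrix.mul_sub, Matrix.one_mul, Matrix.mul_one, hSS]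
    module
  rw [e, Matrix.trace_smul, Matrix.trace_sub] at h
  have := (Complex.le_def.1 h).1
  simp at this
  linarith

theorem siteOp_mul_siteOp_apply {ι : Type} [Fintype ι] [DecidableEq ι] {s r : Fin n} (h : s ≠ r)
    (A B : Matrix ι ι ℂ) (x y : Fin n → ι) :
    (siteOp s A * siteOp r B) x y =
      A (x s) (y s) * B (x r) (y r) *
        if (∀ q, q ≠ s → q ≠ r → x q = y q) then 1 else 0 := by
  have e : siteOp s A * siteOp r B =
      tensorFam (Function.update (Function.update (fun _ => 1) s A) r B) := by
    rw [siteOp, siteOp, tensorFam_mul]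
    congr 1
    funext q
    by_cases hq : q = r
    · subst hq; simp [Function.update_of_ne (Ne.symm h)]
    · simp [Function.update_of_ne hq]
  rw [e, tensorFam_update_apply,
    ← Finset.mul_prod_erase _ _ (Finset.mem_erase.2 ⟨h, Finset.mem_univ s⟩),
    Function.update_self]
  have e2 : ∏ q ∈ (Finset.univ.erase r).erase s,
      (Function.update (fun _ => (1 : Matrix ι ι ℂ)) s A q) (x q) (y q) =
      ∏ q ∈ (Finset.univ.erase r).erase s, if x q = y q then 1 else 0 := by
    refine Finset.prod_congr rfl fun q hq => ?_
    rw [Function.update_of_ne (Finset.ne_of_mem_erase hq), Matrix.one_apply]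
  rw [e2, Finset.prod_ite_zero, Finset.prod_const_one]
  simp only [Finset.mem_erase, Finset.mem_univ, and_true, and_imp]
  ring

theorem IsTracelessBasis.sum_mul_self (ht : IsTracelessBasis t) (hd : 0 < d) :
    ∑ α, t α * t α = ((d : ℂ) - 1 / d) • (1 : Matrix (Fin d) (Fin d) ℂ) := by
  ext i l
  rw [Matrix.sum_apply]
  simp only [Matrix.mul_apply]
  rw [Finset.sum_comm]
  simp only [ht.sum_mul_apply hd, Matrix.smul_apply, Matrix.one_apply, smul_eq_mul,
    Finset.sum_sub_distrib]
  by_cases h : i = l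
  · subst h
    have : ∀ x, (i = x ∧ x = i) ↔ x = i := fun x => ⟨fun h => h.2, fun h => ⟨h.symm, h⟩⟩
    simp [this]
  · have : ∀ x, ¬ (i = x ∧ x = l) := fun x hx => h (hx.1.trans hx.2)
    simp [h, this]

/-- The completeness relation read on two tensor factors: on distinct sites `∑ t_α ⊗ t_α` is the
swap minus `1/d`, and on a single site it contracts to the one-particle Casimir. -/
theorem IsTracelessBasis.sum_siteOp_mul_siteOp (ht : IsTracelessBasis t) (hd : 0 < d)
    (s r : Fin n) :
    ∑ α, siteOp s (t α) * siteOp r (t α) =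
      if s = r then ((d : ℂ) - 1 / d) • 1 else swapOp d s r - (1 / d : ℂ) • 1 := by
  split_ifs with h
  · subst h
    have e : ∀ α, siteOp s (t α) * siteOp s (t α) = siteOp s (t α * t α) := by
      intro α
      rw [siteOp, siteOp, tensorFam_mul]
      congr 1
      funext q
      by_cases hq : q = s
      · subst hq; simp
      · simp [Function.update_of_ne hq]
    simp only [e]
    simp only [siteOp]
    rw [← tensorFam_update_sum, ht.sum_mul_self hd, tensorFam_update_smul]
    congr 1
    rw [← tensorFam_one]
    congr 1
    simp
  · ext x y
    rw [Matrix.sum_apply]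
    simp only [siteOp_mul_siteOp_apply h, ← Finset.sum_mul, ht.sum_mul_apply hd]
    rw [Matrix.sub_apply, Matrix.smul_apply, Matrix.one_apply, swapOp_apply, sub_mul, smul_eq_mul]
    congr 1
    · rw [ite_mul_ite_zero, mul_one]
      refine if_congr ⟨fun hx q => ?_, fun hx => ⟨⟨?_, ?_⟩, fun q hqs hqr => ?_⟩⟩ rfl rfl
      · by_cases hqs : q = s
        · subst hqs; rw [Equiv.swap_apply_left]; exact hx.1.2.symm
        · by_cases hqr : q = r
          · subst hqr; rw [Equiv.swap_apply_right]; exact hx.1.1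
          · rw [Equiv.swap_apply_of_ne_of_ne hqs hqr]; exact hx.2 q hqs hqr
      · simpa using hx r
      · simpa using (hx s).symm
      · simpa [Equiv.swap_apply_of_ne_of_ne hqs hqr] using hx q
    · rw [ite_mul_ite_zero, mul_one, mul_ite, mul_one, mul_zero]
      refine if_congr ⟨fun hx => funext fun q => ?_, fun hx => ?_⟩ rfl rfl
      · by_cases hqs : q = s
        · subst hqs; exact hx.1.1
        · by_cases hqr : q = r
          · subst hqr; exact hx.1.2
          · exact hx.2 q hqs hqr
      · subst hx; simp

variable {A : Type} [DecidableEq A]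

theorem one_kronecker_sum {ι κ : Type} (S : Finset κ) (F : κ → Matrix ι ι ℂ) :
    (1 : Matrix A A ℂ) ⊗ₖ (∑ i ∈ S, F i) = ∑ i ∈ S, (1 : Matrix A A ℂ) ⊗ₖ F i := by
  ext x y
  simp [Matrix.sum_apply, Finset.mul_sum, Matrix.kroneckerMap_apply]

variable [Fintype A]

theorem collective_mul_collective (B C : Matrix (Fin d) (Fin d) ℂ) :
    collective A n B * collective A n C = (1 : Matrix A A ℂ) ⊗ₖ (siteSum n B * siteSum n C) := by
  rw [collective, collective, ← Matrix.mul_kronecker_mul, Matrix.one_mul]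

/-- The second moments of the collective generators are bounded by the largest Casimir value. -/
theorem IsTracelessBasis.sum_trace_collective_le (ht : IsTracelessBasis t) (hd : 0 < d)
    {ω : Matrix (A × (Fin n → Fin d)) (A × (Fin n → Fin d)) ℂ} (hω : IsDensityMatrix ω) :
    ∑ α, (ω * (collective A n (t α) * collective A n (t α))).trace.re ≤
      n * (n + d) * (d - 1) / d := by
  have hd0 : (d : ℝ) ≠ 0 := by exact_mod_cast hd.ne'
  have e1 : ∑ α, siteSum n (t α) * siteSum n (t α) = ∑ s : Fin n, ∑ r : Fin n,
      if s = r then ((d : ℂ) - 1 / d) • 1 else swapOp d s r - (1 / d : ℂ) • 1 := by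
    simp only [siteSum, Finset.sum_mul, Finset.mul_sum, ← ht.sum_siteOp_mul_siteOp hd]
    rw [Finset.sum_comm]
    conv_lhs => enter [2, r]; rw [Finset.sum_comm]
    rw [Finset.sum_comm]
  have e2 : ∑ α, (ω * (collective A n (t α) * collective A n (t α))).trace.re =
      ∑ s : Fin n, ∑ r : Fin n, (ω * ((1 : Matrix A A ℂ) ⊗ₖ
        (if s = r then ((d : ℂ) - 1 / d) • 1 else swapOp d s r - (1 / d : ℂ) • 1))).trace.re := by
    simp only [← Complex.re_sum, ← Matrix.trace_sum, ← Finset.mul_sum,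
      collective_mul_collective, ← one_kronecker_sum, e1]
  have hreal : ∀ x : ℝ, (ω * ((1 : Matrix A A ℂ) ⊗ₖ
      ((x : ℂ) • (1 : Matrix (Fin n → Fin d) (Fin n → Fin d) ℂ)))).trace.re = x := by
    intro x
    rw [Matrix.kronecker_smul, Matrix.one_kronecker_one, Matrix.mul_smul, Matrix.mul_one,
      Matrix.trace_smul, hω.2]
    simp
  have hswap : ∀ s r : Fin n,
      (ω * ((1 : Matrix A A ℂ) ⊗ₖ (swapOp d s r - (1 / d : ℂ) • 1))).trace.re ≤
        (1 - 1 / d : ℝ) := by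
    intro s r
    have h1 := hreal (1 / d)
    have h2 := trace_mul_re_le_of_mul_self_eq_one hω.1 (S := (1 : Matrix A A ℂ) ⊗ₖ swapOp d s r)
      (by
        unfold Matrix.IsHermitian
        rw [Matrix.conjTranspose_kronecker, Matrix.conjTranspose_one, (swapOp_isHermitian s r).eq])
      (by rw [← Matrix.mul_kronecker_mul, swapOp_mul_self, Matrix.one_mul,
        Matrix.one_kronecker_one])
    push_cast at h1
    rw [hω.2, Complex.one_re] at h2
    have e : (1 : Matrix A A ℂ) ⊗ₖ (swapOp d s r - (1 / d : ℂ) • 1) =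
        (1 : Matrix A A ℂ) ⊗ₖ swapOp d s r - (1 : Matrix A A ℂ) ⊗ₖ ((1 / d : ℂ) • 1) := by
      ext x y
      simp only [Matrix.kroneckerMap_apply, Matrix.sub_apply, mul_sub]
    rw [e, Matrix.mul_sub, Matrix.trace_sub, Complex.sub_re, h1]
    linarith
  rw [e2]
  -- Every pair contributes at most `1 - 1/d`; a coinciding pair contributes `d - 1/d`, that is, `d
  -- - 1` more.
  calc _ ≤ ∑ s : Fin n, ∑ r : Fin n, ((if s = r then (d : ℝ) - 1 else 0) + (1 - 1 / d)) := by
        refine Finset.sum_le_sum fun s _ => Finset.sum_le_sum fun r _ => ?_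
        split_ifs with h
        · have := hreal ((d : ℝ) - 1 / d)
          push_cast at this
          rw [this]
          linarith
        · simpa using hswap s r
    _ = n * (n + d) * (d - 1) / d := by
        simp only [Finset.sum_add_distrib, Finset.sum_ite_eq, Finset.mem_univ, if_true,
          Finset.sum_const, Finset.card_univ, Fintype.card_fin, nsmul_eq_mul]
        field_simp
        ring

end Casimir

/-! ### The lower bound on the cost of every input state. -/

section Optimality

variable {d n : ℕ} {Θ : Set (Fin (d ^ 2 - 1) → ℝ)}
  {V : (Fin (d ^ 2 - 1) → ℝ) → Matrix (Fin d) (Fin d) ℂ} {θ : Fin (d ^ 2 - 1) → ℝ}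
  {A : Type} [Fintype A] [DecidableEq A]

theorem IsNormalizedParametrization.isDensityMatrix_outputState
    (h : IsNormalizedParametrization Θ V θ)
    {ω : Matrix (A × (Fin n → Fin d)) (A × (Fin n → Fin d)) ℂ} (hω : IsDensityMatrix ω) :
    IsDensityMatrix (outputState V ω θ) := by
  refine ⟨hω.1.mul_mul_conjTranspose_same _, ?_⟩
  have := outputUnitary_conjTranspose_mul_self (A := A) (n := n)
    (h.conjTranspose_mul_self h.mem)
  unfold outputUnitary at this
  rw [outputState, Matrix.trace_mul_comm, ← Matrix.mul_assoc, this, Matrix.one_mul, hω.2]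

theorem outputState_mul_conj (hV : (V θ)ᴴ * V θ = 1)
    (ω B : Matrix (A × (Fin n → Fin d)) (A × (Fin n → Fin d)) ℂ) :
    (outputState V ω θ * (outputUnitary A n (V θ) * B * (outputUnitary A n (V θ))ᴴ)).trace =
      (ω * B).trace := by
  have hW := outputUnitary_conjTranspose_mul_self (A := A) (n := n) hV
  change (outputUnitary A n (V θ) * ω * (outputUnitary A n (V θ))ᴴ *
    (outputUnitary A n (V θ) * B * (outputUnitary A n (V θ))ᴴ)).trace = _
  set W := outputUnitary A n (V θ)
  have e : W * ω * Wᴴ * (W * B * Wᴴ) = W * (ω * (Wᴴ * W) * B * Wᴴ) := by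
    simp only [Matrix.mul_assoc]
  rw [e, hW, Matrix.mul_one, Matrix.trace_mul_comm, Matrix.mul_assoc, hW, Matrix.mul_one]

theorem conj_mul_conj {V : Matrix (Fin d) (Fin d) ℂ} (hV : Vᴴ * V = 1)
    (B C : Matrix (A × (Fin n → Fin d)) (A × (Fin n → Fin d)) ℂ) :
    (outputUnitary A n V * B * (outputUnitary A n V)ᴴ) *
      (outputUnitary A n V * C * (outputUnitary A n V)ᴴ) =
      outputUnitary A n V * (B * C) * (outputUnitary A n V)ᴴ := by
  have hW := outputUnitary_conjTranspose_mul_self (A := A) (n := n) hV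
  set W := outputUnitary A n V
  have e : W * B * Wᴴ * (W * C * Wᴴ) = W * (B * (Wᴴ * W) * C) * Wᴴ := by
    simp only [Matrix.mul_assoc]
  rw [e, hW, Matrix.mul_one]

theorem trace_mul_eq_ofReal_re {ι : Type} [Fintype ι] {ρ K : Matrix ι ι ℂ} (hρ : ρ.IsHermitian)
    (hK : K.IsHermitian) : (((ρ * K).trace.re : ℝ) : ℂ) = (ρ * K).trace := by
  rw [← Complex.conj_eq_iff_re]
  change star (ρ * K).trace = _
  rw [← Matrix.trace_conjTranspose, Matrix.conjTranspose_mul, hρ.eq, hK.eq, Matrix.trace_mul_comm]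

/-- The trace of the Fisher information matrix of any measurement on `N` copies. -/
theorem IsNormalizedParametrization.trace_fisherInfo_le (h : IsNormalizedParametrization Θ V θ)
    (hd : 0 < d) {ω : Matrix (A × (Fin n → Fin d)) (A × (Fin n → Fin d)) ℂ}
    (hω : IsDensityMatrix ω) (N : ℕ) (M : POVM (Fin N → A × (Fin n → Fin d))) :
    (fisherInfo (fun η => tensorPow N (outputState V ω η)) θ M).trace ≤
      4 * N * (n * (n + d) * (d - 1) / d) := by
  have hV := h.conjTranspose_mul_self h.mem
  have hρ := h.isDensityMatrix_outputState hω
  have hK := h.isGeneratedBy_outputState ω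
  set K : Fin (d ^ 2 - 1) → Matrix (A × (Fin n → Fin d)) (A × (Fin n → Fin d)) ℂ :=
    fun α => outputUnitary A n (V θ) * collective A n (generator V θ α) *
      (outputUnitary A n (V θ))ᴴ with hKdef
  -- Subtracting the means removes the `N(N-1)` term; without this the bound would grow like `N²`.
  set c : Fin (d ^ 2 - 1) → ℝ := fun α => (outputState V ω θ * K α).trace.re with hc
  have hcK : ∀ α, ((c α : ℝ) : ℂ) = (outputState V ω θ * K α).trace := fun α =>
    trace_mul_eq_ofReal_re hρ.1.1 (hK.isHermitian α)
  have hK' := hK.sub_smul_one c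
  have hK0 : ∀ α, (outputState V ω θ * (K α - ((c α : ℝ) : ℂ) • 1)).trace = 0 := by
    intro α
    rw [Matrix.mul_sub, Matrix.trace_sub, Matrix.mul_smul, Matrix.mul_one, Matrix.trace_smul,
      hρ.2, hcK, smul_eq_mul, mul_one, sub_self]
  rw [trace_eq_sum_quadForm]
  calc _ ≤ ∑ α, 4 * N * (ω * (collective A n (generator V θ α) *
          collective A n (generator V θ α))).trace.re := by
        refine Finset.sum_le_sum fun α _ => ?_
        refine (fisherInfo_tensorPow_quadForm_le hρ hK' hK0 N M (Pi.single α 1)).trans ?_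
        have e : ∑ β, ((Pi.single α (1 : ℝ) : Fin (d ^ 2 - 1) → ℝ) β : ℂ) •
            (K β - ((c β : ℝ) : ℂ) • (1 : Matrix (A × (Fin n → Fin d)) (A × (Fin n → Fin d)) ℂ)) =
            K α - ((c α : ℝ) : ℂ) • 1 := by
          rw [Finset.sum_eq_single α]
          · simp
          · intro β _ hβ
            simp [Pi.single_eq_of_ne hβ]
          · simp
        rw [e]
        -- Variance equals second moment minus squared mean, and the squared mean is then discarded.
        have e2 : (outputState V ω θ * ((K α - ((c α : ℝ) : ℂ) • 1) *
            (K α - ((c α : ℝ) : ℂ) • 1))).trace =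
            (outputState V ω θ * (K α * K α)).trace - ((c α ^ 2 : ℝ) : ℂ) := by
          rw [Matrix.sub_mul, Matrix.mul_sub, Matrix.trace_sub, Matrix.smul_mul, Matrix.one_mul,
            Matrix.mul_smul, Matrix.trace_smul, hK0, Matrix.mul_sub, Matrix.mul_smul,
            Matrix.mul_one, Matrix.mul_sub, Matrix.trace_sub, Matrix.mul_smul, Matrix.trace_smul,
            ← hcK]
          push_cast
          simp only [smul_eq_mul]
          ring
        have e3 : (outputState V ω θ * (K α * K α)).trace =
            (ω * (collective A n (generator V θ α) * collective A n (generator V θ α))).trace := by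
          rw [hKdef, conj_mul_conj hV, outputState_mul_conj hV]
        rw [e2, e3, Complex.sub_re, Complex.ofReal_re]
        have : 0 ≤ c α ^ 2 := sq_nonneg _
        gcongr
        linarith
    _ ≤ _ := by
        rw [← Finset.mul_sum]
        gcongr
        exact h.isTracelessBasis.sum_trace_collective_le hd hω

theorem cast_sq_sub_one (hd : 2 ≤ d) : ((d ^ 2 - 1 : ℕ) : ℝ) = (d : ℝ) ^ 2 - 1 := by
  have : 1 ≤ d ^ 2 := Nat.one_le_pow _ _ (by omega)
  push_cast [this]
  ring

theorem IsNormalizedParametrization.optimalCost_le_scaledCost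
    (h : IsNormalizedParametrization Θ V θ) (hd : 2 ≤ d) (hn : 1 ≤ n)
    {ω : Matrix (A × (Fin n → Fin d)) (A × (Fin n → Fin d)) ℂ} (hω : IsDensityMatrix ω)
    {N : ℕ} (hN : 0 < N) :
    ENNReal.ofReal (optimalCost d n) ≤ scaledCost V θ ω N := by
  have hN0 : (0 : ℝ) < N := by exact_mod_cast hN
  have hd2 : (2 : ℝ) ≤ d := by exact_mod_cast hd
  have hn1 : (1 : ℝ) ≤ n := by exact_mod_cast hn
  have e : ENNReal.ofReal (optimalCost d n) = N * ENNReal.ofReal (optimalCost d n / N) := by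
    rw [← ENNReal.ofReal_natCast, ← ENNReal.ofReal_mul hN0.le]
    congr 1
    field_simp
  rw [e, scaledCost]
  gcongr
  refine le_iInf fun M => ?_
  rw [traceInv]
  split_ifs with hI
  · refine ENNReal.ofReal_le_ofReal ?_
    have hB : (0 : ℝ) < 4 * N * (n * (n + d) * (d - 1) / d) := by
      have : (0 : ℝ) < d - 1 := by linarith
      positivity
    refine le_trans (le_of_eq ?_)
      (trace_inv_ge_of_trace_le hI hB (h.trace_fisherInfo_le (by omega) hω N M))
    rw [cast_sq_sub_one hd, optimalCost]
    have : (d : ℝ) - 1 ≠ 0 := by linarith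
    field_simp
    ring
  · exact le_top

theorem IsNormalizedParametrization.optimalCost_le_figureOfMerit
    (h : IsNormalizedParametrization Θ V θ) (hd : 2 ≤ d) (hn : 1 ≤ n)
    {ω : Matrix (A × (Fin n → Fin d)) (A × (Fin n → Fin d)) ℂ} (hω : IsDensityMatrix ω) :
    ENNReal.ofReal (optimalCost d n) ≤ figureOfMerit V θ ω := by
  refine le_liminf_of_le (by isBoundedDefault) ?_
  filter_upwards [eventually_gt_atTop 0] with N hN
  exact h.optimalCost_le_scaledCost hd hn hω hN

end Optimality

/-! ### Attaining the quantum Fisher information of a pure state -/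

section Attain

variable {ι : Type} [Fintype ι] [DecidableEq ι] {p : ℕ}

/-- A measurement whose outcomes are labelled by an arbitrary finite type. -/
def POVM.ofFintype {κ : Type} [Fintype κ] (E : κ → Matrix ι ι ℂ) (hE : ∀ ξ, (E ξ).PosSemidef)
    (h1 : ∑ ξ, E ξ = 1) : POVM ι where
  outcomes := Fintype.card κ
  element ξ := E ((Fintype.equivFin κ).symm ξ)
  posSemidef ξ := hE _
  sum_eq_one := by rw [← h1]; exact Equiv.sum_comp (Fintype.equivFin κ).symm E

open Classical in
theorem fisherInfo_ofFintype {κ : Type} [Fintype κ] (E : κ → Matrix ι ι ℂ)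
    (hE : ∀ ξ, (E ξ).PosSemidef) (h1 : ∑ ξ, E ξ = 1) (ρ : (Fin p → ℝ) → Matrix ι ι ℂ)
    (θ : Fin p → ℝ) (α β : Fin p) :
    fisherInfo ρ θ (POVM.ofFintype E hE h1) α β =
      ∑ ξ, if 0 < (ρ θ * E ξ).trace.re then
        (partialDeriv ρ θ α * E ξ).trace.re * (partialDeriv ρ θ β * E ξ).trace.re /
          (ρ θ * E ξ).trace.re else 0 := by
  rw [fisherInfo, Matrix.of_apply, Finset.sum_filter]
  exact Equiv.sum_comp (Fintype.equivFin κ).symm (fun ξ => if 0 < (ρ θ * E ξ).trace.re then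
        (partialDeriv ρ θ α * E ξ).trace.re * (partialDeriv ρ θ β * E ξ).trace.re /
          (ρ θ * E ξ).trace.re else 0)

theorem exists_eq_mul_transpose {H : Matrix (Fin p) (Fin p) ℝ} (h : H.PosSemidef) :
    ∃ C : Matrix (Fin p) (Fin p) ℝ, H = C * Cᵀ := by
  open scoped MatrixOrder in
  refine ⟨CFC.sqrt H, ?_⟩
  have h1 := CFC.sqrt_mul_sqrt_self H (Matrix.nonneg_iff_posSemidef.2 h)
  have h2 : (CFC.sqrt H).PosSemidef := Matrix.nonneg_iff_posSemidef.1 (CFC.sqrt_nonneg H)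
  rw [← Matrix.conjTranspose_eq_transpose_of_trivial, h2.1.eq, h1]

/-- Any `C` with `C Cᵀ = H⁻¹` works. It turns vectors with Gram matrix `H` into an orthonormal
family by real combinations. -/
theorem exists_orthonormalizer {H : Matrix (Fin p) (Fin p) ℝ} (h : H.PosDef) :
    ∃ C : Matrix (Fin p) (Fin p) ℝ, Cᵀ * H * C = 1 ∧ (Cᵀ * H)ᵀ * (Cᵀ * H) = H := by
  obtain ⟨C, hC⟩ := exists_eq_mul_transpose h.inv.posSemidef
  have hu : IsUnit H.det := (Matrix.isUnit_iff_isUnit_det H).1 h.isUnit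
  have hT : Hᵀ = H := by simpa using h.isHermitian.eq
  refine ⟨C, ?_, ?_⟩
  · have h1 : C * (Cᵀ * H) = 1 := by
      rw [← Matrix.mul_assoc, ← hC, Matrix.nonsing_inv_mul _ hu]
    exact mul_eq_one_comm.1 h1
  · rw [Matrix.transpose_mul, Matrix.transpose_transpose, hT, Matrix.mul_assoc,
      ← Matrix.mul_assoc C, ← hC, Matrix.nonsing_inv_mul _ hu, Matrix.mul_one]

section

variable {ι : Type} [Fintype ι]

theorem trace_mul_vecMulVec_star (X : Matrix ι ι ℂ) (w : ι → ℂ) :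
    (X * Matrix.vecMulVec w (star w)).trace = star w ⬝ᵥ (X *ᵥ w) := by
  rw [Matrix.mul_vecMulVec, Matrix.trace_vecMulVec, dotProduct_comm]

/-- Probabilities and their derivatives for a rank one outcome on a pure state. -/
theorem trace_pure_mul_vecMulVec (ψ w : ι → ℂ) :
    (Matrix.vecMulVec ψ (star ψ) * Matrix.vecMulVec w (star w)).trace =
      (star ψ ⬝ᵥ w) * (star w ⬝ᵥ ψ) := by
  rw [trace_mul_vecMulVec_star, Matrix.vecMulVec_mulVec, dotProduct_smul]
  simp [mul_comm]

theorem trace_commutator_mul_vecMulVec {K : Matrix ι ι ℂ} (hK : K.IsHermitian) (ψ w : ι → ℂ) :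
    (((-Complex.I) • (K * Matrix.vecMulVec ψ (star ψ) - Matrix.vecMulVec ψ (star ψ) * K)) *
      Matrix.vecMulVec w (star w)).trace.re =
      2 * ((star ψ ⬝ᵥ w) * (star w ⬝ᵥ (K *ᵥ ψ))).im := by
  have h1 : ((K * Matrix.vecMulVec ψ (star ψ)) * Matrix.vecMulVec w (star w)).trace =
      (star ψ ⬝ᵥ w) * (star w ⬝ᵥ (K *ᵥ ψ)) := by
    rw [trace_mul_vecMulVec_star, Matrix.mul_vecMulVec, Matrix.vecMulVec_mulVec, dotProduct_smul]
    simp [mul_comm]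
  have h2 : ((Matrix.vecMulVec ψ (star ψ) * K) * Matrix.vecMulVec w (star w)).trace =
      star ((star ψ ⬝ᵥ w) * (star w ⬝ᵥ (K *ᵥ ψ))) := by
    rw [← h1, ← Matrix.trace_conjTranspose, Matrix.conjTranspose_mul, Matrix.conjTranspose_mul,
      Matrix.conjTranspose_vecMulVec, Matrix.conjTranspose_vecMulVec, star_star, star_star, hK.eq,
      Matrix.trace_mul_comm]
  rw [Matrix.smul_mul, Matrix.sub_mul, Matrix.trace_smul, Matrix.trace_sub, h1, h2]
  simp only [smul_eq_mul, Complex.mul_re, Complex.neg_re, Complex.neg_im, Complex.I_re,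
    Complex.I_im, Complex.sub_re, Complex.sub_im, RCLike.star_def, Complex.conj_re, Complex.conj_im]
  ring

end

/-- For a pure state with centred generators whose Gram matrix `4 ⟨K_α ψ, K_β ψ⟩ = H_{αβ}` is real
and invertible, some measurement has Fisher information `H`. -/
theorem exists_povm_fisherInfo_eq (hp : 0 < p) {ρ : (Fin p → ℝ) → Matrix ι ι ℂ} {θ : Fin p → ℝ}
    {K : Fin p → Matrix ι ι ℂ} {H : Matrix (Fin p) (Fin p) ℝ} {ψ : ι → ℂ}
    (hρ : ρ θ = Matrix.vecMulVec ψ (star ψ)) (hψ : star ψ ⬝ᵥ ψ = 1) (hK : IsGeneratedBy ρ θ K)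
    (hK0 : ∀ α, (ρ θ * K α).trace = 0)
    (hH : ∀ α β, 4 * (ρ θ * (K α * K β)).trace = (H α β : ℂ)) (hpos : H.PosDef) :
    ∃ M : POVM ι, fisherInfo ρ θ M = H := by
  classical
  obtain ⟨C, hC1, hC2⟩ := exists_orthonormalizer hpos
  have hp0 : (p : ℝ) ≠ 0 := by exact_mod_cast hp.ne'
  let Φ : Matrix ι (Fin p) ℂ := Matrix.of fun x α => (K α *ᵥ ψ) x
  let Cc : Matrix (Fin p) (Fin p) ℂ := C.map Complex.ofRealHom
  let Hc : Matrix (Fin p) (Fin p) ℂ := H.map Complex.ofRealHom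
  -- The columns `f_j = -2i ∑ C_{αj} K_α ψ` are orthonormal, thanks to the real Gram matrix, and
  -- orthogonal to `ψ` by centring. The factor `-2i` makes `⟨f_j, K_α ψ⟩` purely imaginary, and the
  -- derivatives of the probabilities are imaginary parts.
  let F : Matrix ι (Fin p) ℂ := (-2 * Complex.I) • (Φ * Cc)
  have hCc : Ccᴴ = Cᵀ.map Complex.ofRealHom := by
    ext i j
    simp [Cc]
  have hΦΦ : (4 : ℂ) • (Φᴴ * Φ) = Hc := by
    ext α β
    have h1 : (Φᴴ * Φ) α β = star (K α *ᵥ ψ) ⬝ᵥ (K β *ᵥ ψ) := rfl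
    have h2 : (ρ θ * (K α * K β)).trace = star (K α *ᵥ ψ) ⬝ᵥ (K β *ᵥ ψ) := by
      rw [hρ, Matrix.trace_mul_comm, trace_mul_vecMulVec_star, Matrix.star_mulVec,
        (hK.isHermitian α).eq, ← Matrix.dotProduct_mulVec, Matrix.mulVec_mulVec]
    rw [Matrix.smul_apply, h1, ← h2, smul_eq_mul, hH]
    simp [Hc]
  have hΦψ : ∀ α, star ψ ⬝ᵥ (K α *ᵥ ψ) = 0 := by
    intro α
    rw [← hK0 α, hρ, Matrix.trace_mul_comm, trace_mul_vecMulVec_star]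
  have hFF : Fᴴ * F = 1 := by
    have h1 : Fᴴ * F = Ccᴴ * ((4 : ℂ) • (Φᴴ * Φ)) * Cc := by
      simp only [F, Matrix.conjTranspose_smul, Matrix.conjTranspose_mul, Matrix.smul_mul,
        Matrix.mul_smul, smul_smul, Matrix.mul_assoc]
      congr 1
      simp only [star_mul', star_neg, RCLike.star_def, Complex.conj_I]
      rw [Complex.conj_ofNat]
      linear_combination (-4 : ℂ) * Complex.I_mul_I
    rw [h1, hΦΦ, hCc]
    simp only [Hc, Cc]
    rw [← Matrix.map_mul, ← Matrix.map_mul, hC1]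
    ext i j
    by_cases hij : i = j <;> simp [Matrix.one_apply, hij]
  have hFΦ : ∀ j α, star (fun x => F x j) ⬝ᵥ (K α *ᵥ ψ) =
      (Complex.I / 2) * (((Cᵀ * H) j α : ℝ) : ℂ) := by
    intro j α
    have h1 : Fᴴ * Φ = (Complex.I / 2) • (Ccᴴ * ((4 : ℂ) • (Φᴴ * Φ))) := by
      simp only [F, Matrix.conjTranspose_smul, Matrix.conjTranspose_mul, Matrix.smul_mul,
        Matrix.mul_smul, smul_smul, Matrix.mul_assoc]
      congr 1
      simp only [star_mul', star_neg, RCLike.star_def, Complex.conj_I]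
      rw [Complex.conj_ofNat]
      ring
    rw [hΦΦ, hCc] at h1
    simp only [Hc] at h1
    rw [← Matrix.map_mul] at h1
    exact congrFun (congrFun h1 j) α
  have hψF : ∀ j, star ψ ⬝ᵥ (fun x => F x j) = 0 := by
    intro j
    have : (fun x => F x j) = ∑ α, ((-2 * Complex.I) * Cc α j) • (K α *ᵥ ψ) := by
      ext x
      simp only [F, Matrix.smul_apply, Matrix.mul_apply, smul_eq_mul, Finset.sum_apply,
        Pi.smul_apply, Finset.mul_sum]
      refine Finset.sum_congr rfl fun α _ => ?_
      change _ * ((K α *ᵥ ψ) x * _) = _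
      ring
    rw [this, dotProduct_sum]
    simp [dotProduct_smul, hΦψ]
  have hFψ : ∀ j, star (fun x => F x j) ⬝ᵥ ψ = 0 := fun j => by
    rw [Matrix.star_dotProduct, hψF, star_zero]
  let a : ℂ := ((1 / Real.sqrt p : ℝ) : ℂ)
  let h2 : ℂ := ((1 / Real.sqrt 2 : ℝ) : ℂ)
  have ha : a * a = 1 / p := by
    simp only [a]
    rw [← Complex.ofReal_mul, div_mul_div_comm, Real.mul_self_sqrt (by positivity)]
    simp
  have hh2 : h2 * h2 = 1 / 2 := by
    simp only [h2]
    rw [← Complex.ofReal_mul, div_mul_div_comm, Real.mul_self_sqrt (by positivity)]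
    simp
  have has : star a = a := Complex.conj_ofReal _
  have hh2s : star h2 = h2 := Complex.conj_ofReal _
  let sg : Bool → ℝ := fun b => if b then 1 else -1
  -- The outcomes `(ψ/√p ± f_j)/√2` all have probability `1/(2p)`. In the sum over the two signs the
  -- cross terms cancel, so the outcomes resolve the projection `Q` onto the span of `ψ` and the
  -- `f_j`.
  let w : Fin p × Bool → ι → ℂ := fun jb => h2 • (a • ψ + ((sg jb.2 : ℝ) : ℂ) • fun x => F x jb.1)
  let Q : Matrix ι ι ℂ := Matrix.vecMulVec ψ (star ψ) + F * Fᴴ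
  have hsumw : ∑ jb, Matrix.vecMulVec (w jb) (star (w jb)) = Q := by
    rw [Fintype.sum_prod_type]
    have h1 : ∀ j, ∑ b, Matrix.vecMulVec (w (j, b)) (star (w (j, b))) =
        (1 / p : ℂ) • Matrix.vecMulVec ψ (star ψ) +
          Matrix.vecMulVec (fun x => F x j) (star fun x => F x j) := by
      intro j
      rw [Fintype.sum_bool]
      ext x y
      simp only [w, sg, Matrix.add_apply, Matrix.smul_apply, Matrix.vecMulVec_apply, Pi.smul_apply,
        Pi.add_apply, Pi.star_apply, smul_eq_mul, star_mul', star_add, has, hh2s, if_true,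
        Complex.ofReal_one, Complex.ofReal_neg, Bool.false_eq_true, if_false, star_one, star_neg]
      rw [← ha]
      linear_combination (2 * (a * a * ψ x * star (ψ y) + F x j * star (F y j))) * hh2
    simp only [h1, Finset.sum_add_distrib, Finset.sum_const, Finset.card_univ, Fintype.card_fin, Q]
    congr 1
    · rw [← Nat.cast_smul_eq_nsmul ℂ, smul_smul, mul_one_div_cancel (by exact_mod_cast hp0),
        one_smul]
    · ext x y
      simp [Matrix.sum_apply, Matrix.mul_apply, Matrix.vecMulVec_apply]
  have hQh : Qᴴ = Q := by
    simp only [Q, Matrix.conjTranspose_add, Matrix.conjTranspose_vecMulVec, star_star,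
      Matrix.conjTranspose_mul, Matrix.conjTranspose_conjTranspose]
  have e1 : Matrix.vecMulVec ψ (star ψ) * F = 0 := by
    rw [Matrix.vecMulVec_mul]
    ext x j
    exact mul_eq_zero_of_right _ (hψF j)
  have hQQ : Q * Q = Q := by
    have e2 : Fᴴ * Matrix.vecMulVec ψ (star ψ) = 0 := by
      rw [Matrix.mul_vecMulVec]
      ext j x
      exact mul_eq_zero_of_left (hFψ j) _
    simp only [Q, Matrix.add_mul, Matrix.mul_add]
    rw [Matrix.vecMulVec_mul_vecMulVec, hψ, one_smul, ← Matrix.mul_assoc, e1, Matrix.zero_mul,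
      Matrix.mul_assoc F, e2, Matrix.mul_zero, Matrix.mul_assoc F, ← Matrix.mul_assoc Fᴴ, hFF,
      Matrix.one_mul]
    simp
  -- The complement `1 - Q` completes the measurement; it annihilates `ψ`, so it never occurs and
  -- adds no information.
  let E : Option (Fin p × Bool) → Matrix ι ι ℂ := fun o =>
    o.elim (1 - Q) fun jb => Matrix.vecMulVec (w jb) (star (w jb))
  have hE : ∀ o, (E o).PosSemidef := by
    rintro (_ | jb)
    · have : (1 - Q)ᴴ * (1 - Q) = E none := by
        change _ = 1 - Q
        rw [Matrix.conjTranspose_sub, hQh, Matrix.conjTranspose_one]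
        simp [Matrix.sub_mul, Matrix.mul_sub, hQQ]
      exact this ▸ Matrix.posSemidef_conjTranspose_mul_self (1 - Q)
    · exact Matrix.posSemidef_vecMulVec_self_star _
  have hE1 : ∑ o, E o = 1 := by
    rw [Fintype.sum_option]
    simp only [E, Option.elim]
    rw [hsumw]
    abel
  refine ⟨POVM.ofFintype E hE hE1, ?_⟩
  have hψw : ∀ jb, star ψ ⬝ᵥ w jb = h2 * a := by
    intro jb
    simp only [w, dotProduct_smul, dotProduct_add, hψ, hψF, smul_eq_mul]
    ring
  have hprob : ∀ jb, (ρ θ * E (some jb)).trace.re = 1 / (2 * p) := by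
    intro jb
    simp only [E, Option.elim]
    rw [hρ, trace_pure_mul_vecMulVec, hψw, Matrix.star_dotProduct, hψw, star_mul', has, hh2s]
    have : h2 * a * (h2 * a) = ((1 / (2 * p) : ℝ) : ℂ) := by
      rw [mul_mul_mul_comm, ha, hh2]
      push_cast
      ring
    rw [this, Complex.ofReal_re]
  have hnone : ¬ 0 < (ρ θ * E none).trace.re := by
    simp only [E, Option.elim]
    have : ρ θ * (1 - Q) = 0 := by
      rw [hρ, Matrix.mul_sub, Matrix.mul_one]
      simp only [Q, Matrix.mul_add]
      rw [Matrix.vecMulVec_mul_vecMulVec, hψ, one_smul, ← Matrix.mul_assoc, e1, Matrix.zero_mul]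
      simp
    rw [this]
    simp
  have hder : ∀ jb α, (partialDeriv ρ θ α * E (some jb)).trace.re =
      sg jb.2 * (1 / (2 * Real.sqrt p)) * (Cᵀ * H) jb.1 α := by
    intro jb α
    simp only [E, Option.elim]
    rw [hK.partialDeriv_eq, hρ, trace_commutator_mul_vecMulVec (hK.isHermitian α), hψw]
    have h3 : star (w jb) ⬝ᵥ (K α *ᵥ ψ) =
        h2 * (((sg jb.2 : ℝ) : ℂ) * ((Complex.I / 2) * (((Cᵀ * H) jb.1 α : ℝ) : ℂ))) := by
      simp only [w, star_smul, star_add, smul_dotProduct, add_dotProduct, hΦψ, hFΦ, has, hh2s,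
        smul_eq_mul, RCLike.star_def, Complex.conj_ofReal]
      ring
    have h4 : h2 * a * (star (w jb) ⬝ᵥ (K α *ᵥ ψ)) =
        ((sg jb.2 * (1 / (4 * Real.sqrt p)) * (Cᵀ * H) jb.1 α : ℝ) : ℂ) * Complex.I := by
      rw [h3]
      have : h2 * a * (h2 * (((sg jb.2 : ℝ) : ℂ) * ((Complex.I / 2) *
          (((Cᵀ * H) jb.1 α : ℝ) : ℂ)))) = (h2 * h2) * (a * (((sg jb.2 : ℝ) : ℂ) *
          ((Complex.I / 2) * (((Cᵀ * H) jb.1 α : ℝ) : ℂ)))) := by ring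
      rw [this, hh2]
      simp only [a]
      push_cast
      ring
    rw [h4, Complex.mul_I_im, Complex.ofReal_re]
    ring
  ext α β
  rw [fisherInfo_ofFintype, Fintype.sum_option, if_neg hnone, zero_add, Fintype.sum_prod_type]
  have hsqrt : Real.sqrt p * Real.sqrt p = p := Real.mul_self_sqrt (by positivity)
  have hs0 : Real.sqrt p ≠ 0 := by positivity
  rw [← hC2, Matrix.mul_apply]
  refine Finset.sum_congr rfl fun j _ => ?_
  have hpp : (0 : ℝ) < 1 / (2 * p) := by positivity
  rw [Fintype.sum_bool]
  simp only [hprob, hder, hpp, if_true, sg, Matrix.transpose_apply, Bool.false_eq_true, if_false]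
  -- The two signs `±` contribute equally, and together give `(CᵀH)_{jα} (CᵀH)_{jβ}`; summing over
  -- `j` gives `H`.
  have key : ∀ r u v : ℝ, r ≠ 0 →
      1 * (1 / (2 * r)) * u * (1 * (1 / (2 * r)) * v) / (1 / (2 * (r * r))) +
        -1 * (1 / (2 * r)) * u * (-1 * (1 / (2 * r)) * v) / (1 / (2 * (r * r))) = u * v := by
    intro r u v hr
    field_simp
    ring
  have := key (Real.sqrt p) ((Cᵀ * H) j α) ((Cᵀ * H) j β) hs0
  rwa [hsqrt] at this

end Attain

/-! ### Pure state models -/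

/-- A pure state model at `θ` with centred generators `K α` and real invertible quantum Fisher
information `H`. -/
structure IsPureModel {ι : Type} [Fintype ι] {p : ℕ} (ρ : (Fin p → ℝ) → Matrix ι ι ℂ)
    (θ : Fin p → ℝ) (K : Fin p → Matrix ι ι ℂ) (H : Matrix (Fin p) (Fin p) ℝ) (ψ : ι → ℂ) :
    Prop where
  pure : ρ θ = Matrix.vecMulVec ψ (star ψ)
  normalized : star ψ ⬝ᵥ ψ = 1
  isGeneratedBy : IsGeneratedBy ρ θ K
  centred : ∀ α, (ρ θ * K α).trace = 0
  gram : ∀ α β, 4 * (ρ θ * (K α * K β)).trace = (H α β : ℂ)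
  posDef : H.PosDef

namespace IsPureModel

variable {ι : Type} [Fintype ι] {p : ℕ} {ρ : (Fin p → ℝ) → Matrix ι ι ℂ}
  {θ : Fin p → ℝ} {K : Fin p → Matrix ι ι ℂ} {H : Matrix (Fin p) (Fin p) ℝ} {ψ : ι → ℂ}

theorem mul_self (h : IsPureModel ρ θ K H ψ) : ρ θ * ρ θ = ρ θ := by
  rw [h.pure, Matrix.vecMulVec_mul_vecMulVec, h.normalized, one_smul]

theorem mul_mul_self (h : IsPureModel ρ θ K H ψ) (α : Fin p) : ρ θ * K α * ρ θ = 0 := by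
  have h0 := h.centred α
  rw [h.pure, Matrix.trace_mul_comm, trace_mul_vecMulVec_star] at h0
  rw [h.pure, Matrix.mul_assoc, Matrix.mul_vecMulVec, Matrix.vecMulVec_mul_vecMulVec, h0, zero_smul]
  ext x y
  simp [Matrix.vecMulVec_apply]

theorem trace_eq_one (h : IsPureModel ρ θ K H ψ) : (ρ θ).trace = 1 := by
  rw [h.pure, Matrix.trace_vecMulVec, dotProduct_comm, h.normalized]

theorem isDensityMatrix (h : IsPureModel ρ θ K H ψ) : IsDensityMatrix (ρ θ) :=
  ⟨h.pure ▸ Matrix.posSemidef_vecMulVec_self_star ψ, h.trace_eq_one⟩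

/-- For a pure state `ρ ∂ρ + ∂ρ ρ = ∂ρ`, so `2 ∂ρ` is a symmetric logarithmic derivative. -/
theorem exists_isSLD (h : IsPureModel ρ θ K H ψ) : ∃ L, IsSLD ρ θ L := by
  refine ⟨fun α => (2 : ℂ) • partialDeriv ρ θ α, fun α => ⟨?_, ?_⟩⟩
  · change ((2 : ℂ) • partialDeriv ρ θ α)ᴴ = (2 : ℂ) • partialDeriv ρ θ α
    rw [h.isGeneratedBy.partialDeriv_eq, Matrix.conjTranspose_smul, Matrix.conjTranspose_smul,
      Matrix.conjTranspose_sub, Matrix.conjTranspose_mul, Matrix.conjTranspose_mul,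
      h.isDensityMatrix.1.1.eq, (h.isGeneratedBy.isHermitian α).eq]
    simp only [RCLike.star_def, map_neg, Complex.conj_I, Complex.conj_ofNat]
    module
  · have h1 : ρ θ * partialDeriv ρ θ α + partialDeriv ρ θ α * ρ θ = partialDeriv ρ θ α := by
      rw [h.isGeneratedBy.partialDeriv_eq]
      simp only [Matrix.mul_smul, Matrix.smul_mul, Matrix.mul_sub, Matrix.sub_mul]
      rw [Matrix.mul_assoc (K α), h.mul_self, ← Matrix.mul_assoc, ← Matrix.mul_assoc, h.mul_self,
        h.mul_mul_self]
      module
    rw [Matrix.mul_smul, Matrix.smul_mul, ← smul_add, h1, smul_smul]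
    norm_num

/-- Symmetric logarithmic derivatives are not unique on a singular state. The value is nevertheless
fixed, because `tr(∂_α ρ ∂_β ρ)` is half of it; evaluating the same trace from the commutators gives
`H`. -/
theorem quantumFisherInfo_eq (h : IsPureModel ρ θ K H ψ) {L : Fin p → Matrix ι ι ℂ}
    (hL : IsSLD ρ θ L) : quantumFisherInfo (ρ θ) L = H := by
  set P := ρ θ with hP
  have hPP : P * P = P := h.mul_self
  have hD : ∀ α, partialDeriv ρ θ α = (1 / 2 : ℂ) • (P * L α + L α * P) := fun α => (hL α).2
  -- Compressing the derivative by `P` kills the commutator, hence the compression of `L` as well.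
  have hPLP : ∀ α, P * L α * P = 0 := by
    intro α
    have h1 : P * partialDeriv ρ θ α * P = 0 := by
      rw [h.isGeneratedBy.partialDeriv_eq]
      simp only [Matrix.mul_smul, Matrix.smul_mul, Matrix.mul_sub, Matrix.sub_mul, ← hP]
      rw [← Matrix.mul_assoc, ← Matrix.mul_assoc, hPP, Matrix.mul_assoc (P * K α), hPP, sub_self,
        smul_zero]
    rw [hD] at h1
    simp only [Matrix.mul_smul, Matrix.smul_mul, Matrix.mul_add, Matrix.add_mul] at h1
    rw [← Matrix.mul_assoc, ← Matrix.mul_assoc, hPP, Matrix.mul_assoc (P * L α), hPP, ← two_smul ℂ,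
      smul_smul] at h1
    simpa using h1
  ext α β
  have h1 : (partialDeriv ρ θ α * partialDeriv ρ θ β).trace =
      (1 / 2 : ℂ) * (P * ((1 / 2 : ℂ) • (L α * L β + L β * L α))).trace := by
    rw [hD, hD]
    have e1 : (P * L α + L α * P) * (P * L β + L β * P) =
        P * L α * P * L β + P * (L α * L β) * P + L α * (P * P) * L β + L α * (P * L β * P) := by
      simp only [Matrix.mul_add, Matrix.add_mul, Matrix.mul_assoc]
      abel
    have e2 : (P * (L α * L β) * P).trace = (P * (L α * L β)).trace := by
      rw [Matrix.trace_mul_comm, ← Matrix.mul_assoc, hPP]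
    have e3 : (L α * P * L β).trace = (P * (L β * L α)).trace := by
      rw [Matrix.mul_assoc, Matrix.trace_mul_comm, Matrix.mul_assoc]
    rw [Matrix.smul_mul, Matrix.mul_smul, e1, hPLP, hPLP, hPP]
    simp only [Matrix.trace_smul, Matrix.trace_add, Matrix.zero_mul, Matrix.mul_zero, e2, e3,
      Matrix.mul_smul, Matrix.mul_add, Matrix.trace_zero, smul_eq_mul]
    ring
  have h2 : (partialDeriv ρ θ α * partialDeriv ρ θ β).trace =
      (P * (K α * K β)).trace + (P * (K β * K α)).trace := by
    rw [h.isGeneratedBy.partialDeriv_eq, h.isGeneratedBy.partialDeriv_eq, ← hP]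
    have e1 : (K α * P - P * K α) * (K β * P - P * K β) =
        K α * (P * K β * P) - K α * (P * P) * K β - P * (K α * K β) * P + P * K α * P * K β := by
      simp only [Matrix.mul_sub, Matrix.sub_mul, Matrix.mul_assoc]
      abel
    have e2 : (P * (K α * K β) * P).trace = (P * (K α * K β)).trace := by
      rw [Matrix.trace_mul_comm, ← Matrix.mul_assoc, hPP]
    have e3 : (K α * P * K β).trace = (P * (K β * K α)).trace := by
      rw [Matrix.mul_assoc, Matrix.trace_mul_comm, Matrix.mul_assoc]
    rw [Matrix.smul_mul, Matrix.mul_smul, smul_smul, e1, h.mul_mul_self, h.mul_mul_self, hPP]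
    simp only [Matrix.trace_smul, Matrix.trace_add, Matrix.trace_sub, Matrix.zero_mul,
      Matrix.mul_zero, e2, e3, Matrix.trace_zero, smul_eq_mul, neg_mul_neg, Complex.I_mul_I]
    ring
  have hs : H β α = H α β := by simpa using h.posDef.isHermitian.apply α β
  have h3 : (P * ((1 / 2 : ℂ) • (L α * L β + L β * L α))).trace = (H α β : ℂ) := by
    have g1 := h.gram α β
    have g2 := h.gram β α
    rw [hs] at g2
    linear_combination (-2 : ℂ) * h1 + 2 * h2 + (1 / 2 : ℂ) * g1 + (1 / 2 : ℂ) * g2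
  rw [quantumFisherInfo, Matrix.of_apply, h3, Complex.ofReal_re]

theorem quadForm_eq (h : IsPureModel ρ θ K H ψ) (c : Fin p → ℝ) :
    4 * (ρ θ * ((∑ α, (c α : ℂ) • K α) * (∑ α, (c α : ℂ) • K α))).trace.re = c ⬝ᵥ (H *ᵥ c) := by
  have h1 : 4 * (ρ θ * ((∑ α, (c α : ℂ) • K α) * (∑ α, (c α : ℂ) • K α))).trace =
      ((c ⬝ᵥ (H *ᵥ c) : ℝ) : ℂ) := by
    simp only [dotProduct, Matrix.mulVec, Finset.sum_mul, Finset.mul_sum, Matrix.trace_sum,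
      Matrix.smul_mul, Matrix.mul_smul, Matrix.trace_smul, smul_eq_mul, Complex.ofReal_sum,
      Complex.ofReal_mul, ← h.gram]
    rw [Finset.sum_comm]
    refine Finset.sum_congr rfl fun α _ => Finset.sum_congr rfl fun β _ => ?_
    ring
  have h2 := congrArg Complex.re h1
  rw [Complex.ofReal_re] at h2
  rw [← h2]
  simp

variable [DecidableEq ι]

theorem tensorPow (h : IsPureModel ρ θ K H ψ) {N : ℕ} (hN : 0 < N) :
    IsPureModel (fun η => tensorPow N (ρ η)) θ (fun α => siteSum N (K α)) ((N : ℝ) • H)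
      (fun x => ∏ s, ψ (x s)) where
  pure := by
    ext x y
    simp [tensorPow_eq_tensorFam, tensorFam_apply, h.pure, Matrix.vecMulVec_apply,
      Finset.prod_mul_distrib]
  normalized := by
    have h1 := trace_tensorPow (k := N) h.trace_eq_one
    rw [← h1]
    simp only [Matrix.trace, Matrix.diag_apply, tensorPow_eq_tensorFam, tensorFam_apply, h.pure,
      Matrix.vecMulVec_apply, Finset.prod_mul_distrib, dotProduct, Pi.star_apply]
    refine Finset.sum_congr rfl fun x _ => ?_
    rw [star_prod, mul_comm]
  isGeneratedBy := h.isGeneratedBy.tensorPow N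
  centred α := by rw [trace_tensorPow_mul_siteSum h.trace_eq_one, h.centred, mul_zero]
  gram α β := by
    rw [trace_tensorPow_mul_siteSum_mul_siteSum h.trace_eq_one, h.centred, Matrix.smul_apply,
      smul_eq_mul, Complex.ofReal_mul, ← h.gram]
    push_cast
    ring
  posDef := h.posDef.smul (by exact_mod_cast hN)

/-- The scaled cost of a pure state model does not depend on the number of copies. -/
theorem mul_iInf_traceInv (h : IsPureModel ρ θ K H ψ) (hp : 0 < p) {N : ℕ} (hN : 0 < N) :
    (N : ℝ≥0∞) * ⨅ M : POVM (Fin N → ι),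
      traceInv (fisherInfo (fun η => UnitaryEstimation.tensorPow N (ρ η)) θ M) =
        ENNReal.ofReal H⁻¹.trace := by
  have hN0 : (0 : ℝ) < N := by exact_mod_cast hN
  have hu : IsUnit H.det := (Matrix.isUnit_iff_isUnit_det H).1 h.posDef.isUnit
  have hNH := h.tensorPow hN
  have hinv : ((N : ℝ) • H)⁻¹ = (N : ℝ)⁻¹ • H⁻¹ := by
    refine Matrix.inv_eq_right_inv ?_
    rw [Matrix.smul_mul, Matrix.mul_smul, smul_smul, Matrix.mul_nonsing_inv _ hu,
      mul_inv_cancel₀ hN0.ne', one_smul]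
  have hcost : (N : ℝ≥0∞) * ENNReal.ofReal (((N : ℝ) • H)⁻¹).trace = ENNReal.ofReal H⁻¹.trace := by
    rw [← ENNReal.ofReal_natCast, ← ENNReal.ofReal_mul hN0.le, hinv, Matrix.trace_smul, smul_eq_mul,
      mul_inv_cancel_left₀ hN0.ne']
  rw [← hcost]
  congr 1
  refine le_antisymm ?_ (le_iInf fun M => ?_)
  · obtain ⟨M, hM⟩ := exists_povm_fisherInfo_eq hp hNH.pure hNH.normalized hNH.isGeneratedBy
      hNH.centred hNH.gram hNH.posDef
    refine (iInf_le _ M).trans (le_of_eq ?_)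
    rw [hM, traceInv, if_pos hNH.posDef]
  · rw [traceInv]
    split_ifs with hI
    · refine ENNReal.ofReal_le_ofReal (trace_inv_le_of_quadForm_le hI hNH.posDef fun c => ?_)
      refine (fisherInfo_quadForm_le hNH.isDensityMatrix.1 hNH.isGeneratedBy M c).trans ?_
      exact (hNH.quadForm_eq c).le
    · exact le_top

end IsPureModel

/-! ### Inverses of matrices close to a scalar -/

section Inverse

variable {p : ℕ} {H : Matrix (Fin p) (Fin p) ℝ}

theorem posDef_of_quadForm_ge (hH : H.IsHermitian) {a : ℝ} (ha : 0 < a)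
    (h : ∀ c : Fin p → ℝ, a * (c ⬝ᵥ c) ≤ c ⬝ᵥ (H *ᵥ c)) : H.PosDef := by
  refine Matrix.PosDef.of_dotProduct_mulVec_pos hH fun x hx => ?_
  rw [star_trivial]
  refine lt_of_lt_of_le (mul_pos ha ?_) (h x)
  have := Matrix.dotProduct_star_self_pos_iff.2 hx
  rwa [star_trivial] at this

/-- With `y = H⁻¹ x`, combine `a |y|² ≤ x·y` with `|x - a y|² ≥ 0`. -/
theorem posSemidef_smul_one_sub_inv (hH : H.PosDef) {a : ℝ} (ha : 0 < a)
    (h : ∀ c : Fin p → ℝ, a * (c ⬝ᵥ c) ≤ c ⬝ᵥ (H *ᵥ c)) : (a⁻¹ • 1 - H⁻¹).PosSemidef := by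
  have hu : IsUnit H.det := (Matrix.isUnit_iff_isUnit_det H).1 hH.isUnit
  refine Matrix.PosSemidef.of_dotProduct_mulVec_nonneg
    (Matrix.IsHermitian.sub (by simp [Matrix.IsHermitian]) hH.isHermitian.inv) fun x => ?_
  rw [star_trivial, Matrix.sub_mulVec, Matrix.smul_mulVec, Matrix.one_mulVec, dotProduct_sub,
    dotProduct_smul, smul_eq_mul]
  set y := H⁻¹ *ᵥ x with hy
  have hx : H *ᵥ y = x := by
    rw [hy, Matrix.mulVec_mulVec, Matrix.mul_nonsing_inv _ hu, Matrix.one_mulVec]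
  have h1 := h y
  rw [hx, dotProduct_comm y x] at h1
  have h2 : 0 ≤ (x - a • y) ⬝ᵥ (x - a • y) := by
    have := dotProduct_star_self_nonneg (x - a • y)
    rwa [star_trivial] at this
  simp only [sub_dotProduct, dotProduct_sub, smul_dotProduct, dotProduct_smul, smul_eq_mul] at h2
  rw [dotProduct_comm y x] at h2
  have h3 : a * (x ⬝ᵥ y) ≤ x ⬝ᵥ x := by nlinarith
  have h4 : x ⬝ᵥ y = a⁻¹ * (a * (x ⬝ᵥ y)) := by field_simp
  rw [h4, ← mul_sub]
  exact mul_nonneg (inv_nonneg.2 ha.le) (by linarith)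

/-- With `y = H⁻¹ x`, expand the `H`-norm of `y - x/b` and bound `x·Hx` by `b |x|²`. -/
theorem posSemidef_inv_sub_smul_one (hH : H.PosDef) {b : ℝ} (hb : 0 < b)
    (h : ∀ c : Fin p → ℝ, c ⬝ᵥ (H *ᵥ c) ≤ b * (c ⬝ᵥ c)) : (H⁻¹ - b⁻¹ • 1).PosSemidef := by
  have hu : IsUnit H.det := (Matrix.isUnit_iff_isUnit_det H).1 hH.isUnit
  refine Matrix.PosSemidef.of_dotProduct_mulVec_nonneg
    (Matrix.IsHermitian.sub hH.isHermitian.inv (by simp [Matrix.IsHermitian])) fun x => ?_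
  rw [star_trivial, Matrix.sub_mulVec, Matrix.smul_mulVec, Matrix.one_mulVec, dotProduct_sub,
    dotProduct_smul, smul_eq_mul]
  set y := H⁻¹ *ᵥ x with hy
  have hx : H *ᵥ y = x := by
    rw [hy, Matrix.mulVec_mulVec, Matrix.mul_nonsing_inv _ hu, Matrix.one_mulVec]
  have hT : Hᵀ = H := by simpa using hH.isHermitian.eq
  have hyx : y ⬝ᵥ (H *ᵥ x) = x ⬝ᵥ x := by
    rw [Matrix.dotProduct_mulVec, ← Matrix.mulVec_transpose, hT, hx]
  have h2 := hH.posSemidef.dotProduct_mulVec_nonneg (y - b⁻¹ • x)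
  rw [star_trivial, Matrix.mulVec_sub, Matrix.mulVec_smul, hx] at h2
  simp only [sub_dotProduct, dotProduct_sub, smul_dotProduct, dotProduct_smul, smul_eq_mul, hyx]
    at h2
  rw [dotProduct_comm y x] at h2
  have h3 : b⁻¹ * (b⁻¹ * (x ⬝ᵥ (H *ᵥ x))) ≤ b⁻¹ * (b⁻¹ * (b * (x ⬝ᵥ x))) := by
    have := h x
    gcongr
  rw [inv_mul_cancel_left₀ hb.ne'] at h3
  linarith

end Inverse

/-! ### An explicit family of approximate designs -/

section ExplicitDesign

variable {d : ℕ}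

/-- The pure state spanned by the column `k` of `U`. -/
def colState (U : Matrix (Fin d) (Fin d) ℂ) (k : Fin d) : Matrix (Fin d) (Fin d) ℂ :=
  Matrix.vecMulVec (fun x => U x k) (star fun x => U x k)

theorem trace_colState_mul (U T : Matrix (Fin d) (Fin d) ℂ) (k : Fin d) :
    (colState U k * T).trace = ∑ x, ∑ y, T x y * (star (U x k) * U y k) := by
  rw [Matrix.trace_mul_comm, colState, trace_mul_vecMulVec_star]
  simp only [dotProduct, Matrix.mulVec, Finset.mul_sum, Pi.star_apply]
  refine Finset.sum_congr rfl fun x _ => Finset.sum_congr rfl fun y _ => ?_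
  ring

theorem colState_isHermitian (U : Matrix (Fin d) (Fin d) ℂ) (k : Fin d) :
    (colState U k).IsHermitian :=
  (Matrix.posSemidef_vecMulVec_self_star _).1

/-- The sum of the squared expectation values of `T` in the columns of `U`. -/
def diagWeight (U T : Matrix (Fin d) (Fin d) ℂ) : ℝ :=
  ∑ k, (colState U k * T).trace.re ^ 2

theorem diagWeight_nonneg (U T : Matrix (Fin d) (Fin d) ℂ) : 0 ≤ diagWeight U T :=
  Finset.sum_nonneg fun _ _ => sq_nonneg _

theorem diagWeight_one (T : Matrix (Fin d) (Fin d) ℂ) :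
    diagWeight 1 T = ∑ k, (T k k).re ^ 2 := by
  refine Finset.sum_congr rfl fun k _ => ?_
  rw [trace_colState_mul, Finset.sum_eq_single k, Finset.sum_eq_single k]
  · simp
  · intro y _ hy
    simp [hy]
  · simp
  · intro x _ hx
    simp [hx]
  · simp

/-- A primitive root of unity of order `2 p d`. -/
def rootOfUnity (d p : ℕ) : ℂ := Complex.exp (2 * Real.pi * Complex.I / (2 * p * d : ℕ))

theorem isPrimitiveRoot_rootOfUnity {d p : ℕ} (hd : d ≠ 0) (hp : p ≠ 0) :
    IsPrimitiveRoot (rootOfUnity d p) (2 * p * d) :=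
  Complex.isPrimitiveRoot_exp _ (by positivity)

theorem rootOfUnity_ne_zero (d p : ℕ) : rootOfUnity d p ≠ 0 := Complex.exp_ne_zero _

theorem star_rootOfUnity_zpow (d p : ℕ) (j : ℤ) :
    star (rootOfUnity d p ^ j) = rootOfUnity d p ^ (-j) := by
  have h : star (rootOfUnity d p) = (rootOfUnity d p)⁻¹ := by
    rw [rootOfUnity, ← Complex.exp_neg, RCLike.star_def, ← Complex.exp_conj]
    congr 1
    simp only [map_div₀, map_mul, Complex.conj_I, Complex.conj_ofReal, map_natCast,
      Complex.conj_ofNat]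
    ring
  rw [RCLike.star_def] at h ⊢
  rw [map_zpow₀, h, inv_zpow, zpow_neg]

/-- The divisibility hypothesis says that `ζ^j` is a `q`-th root of unity, so the geometric sum is
complete and either vanishes or equals `q`. -/
theorem sum_rootOfUnity_zpow {d p : ℕ} (hd : d ≠ 0) (hp : p ≠ 0) (q : ℕ) (j : ℤ)
    (h : ((2 * p * d : ℕ) : ℤ) ∣ q * j) :
    ∑ a : Fin q, rootOfUnity d p ^ ((a : ℤ) * j) =
      if ((2 * p * d : ℕ) : ℤ) ∣ j then (q : ℂ) else 0 := by
  have hz := isPrimitiveRoot_rootOfUnity hd hp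
  have e : ∀ a : Fin q, rootOfUnity d p ^ ((a : ℤ) * j) = (rootOfUnity d p ^ j) ^ (a : ℕ) := by
    intro a
    rw [mul_comm, zpow_mul, zpow_natCast]
  simp only [e]
  rw [Fin.sum_univ_eq_sum_range (fun a => (rootOfUnity d p ^ j) ^ a) q]
  split_ifs with hj
  · rw [(hz.zpow_eq_one_iff_dvd j).2 hj]
    simp
  · have h1 : rootOfUnity d p ^ j ≠ 1 := fun hc => hj ((hz.zpow_eq_one_iff_dvd j).1 hc)
    rw [geom_sum_eq h1]
    have h2 : (rootOfUnity d p ^ j) ^ q = 1 := by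
      rw [← zpow_natCast, ← zpow_mul, mul_comm]
      exact (hz.zpow_eq_one_iff_dvd _).2 h
    rw [h2]
    simp

/-- The exponent of the phase of the entry `(x, k)` of the basis `a`. -/
def phaseExponent (d p a k x : ℕ) : ℤ :=
  -- As `ζ` has order `2pd`, `ζ^{2d}` has order `p` and `ζ^{2p}` order `d`: a quadratic chirp modulo
  -- `p` times a Fourier character modulo `d`. The extra linear term `a x` upgrades a congruence
  -- modulo `d` to an equality.
  (a : ℤ) * (2 * d * x ^ 2 + x) + (k : ℤ) * (2 * p * x)

/-- The basis with the phases `a (2 d x² + x) + 2 p k x`. -/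
def phaseMatrix (d p a : ℕ) : Matrix (Fin d) (Fin d) ℂ :=
  Matrix.of fun x k => ((1 / Real.sqrt d : ℝ) : ℂ) * rootOfUnity d p ^ phaseExponent d p a k x

theorem star_phaseMatrix_mul (hd : d ≠ 0) (p a : ℕ) (x y k l : Fin d) :
    star (phaseMatrix d p a x k) * phaseMatrix d p a y l =
      (1 / d : ℂ) * rootOfUnity d p ^ (phaseExponent d p a l y - phaseExponent d p a k x) := by
  have hs : (((1 / Real.sqrt d : ℝ) : ℂ)) * (((1 / Real.sqrt d : ℝ) : ℂ)) = 1 / d := by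
    rw [← Complex.ofReal_mul, div_mul_div_comm, Real.mul_self_sqrt (by positivity)]
    simp
  have hstar : star ((1 / Real.sqrt d : ℝ) : ℂ) = ((1 / Real.sqrt d : ℝ) : ℂ) :=
    Complex.conj_ofReal _
  simp only [phaseMatrix, Matrix.of_apply, star_mul', hstar, star_rootOfUnity_zpow]
  rw [sub_eq_neg_add, zpow_add₀ (rootOfUnity_ne_zero d p), ← hs]
  ring

theorem phaseMatrix_mem_unitaryGroup (hd : d ≠ 0) {p : ℕ} (hp : p ≠ 0) (a : ℕ) :
    phaseMatrix d p a ∈ Matrix.unitaryGroup (Fin d) ℂ := by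
  rw [Matrix.mem_unitaryGroup_iff']
  ext k l
  rw [Matrix.mul_apply]
  simp only [Matrix.star_apply, star_phaseMatrix_mul hd]
  have e : ∀ x : Fin d, phaseExponent d p a l x - phaseExponent d p a k x =
      (x : ℤ) * (2 * p * ((l : ℤ) - k)) := by
    intro x
    simp only [phaseExponent]
    ring
  simp only [e]
  rw [← Finset.mul_sum, sum_rootOfUnity_zpow hd hp d _ ⟨(l : ℤ) - k, by push_cast; ring⟩,
    Matrix.one_apply]
  have hiff : ((2 * p * d : ℕ) : ℤ) ∣ 2 * p * ((l : ℤ) - k) ↔ k = l := by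
    constructor
    · intro h
      push_cast at h
      have h1 : (d : ℤ) ∣ (l : ℤ) - k :=
        Int.dvd_of_mul_dvd_mul_left (by positivity) h
      have h2 := Int.eq_zero_of_abs_lt_dvd h1 (by rw [abs_lt]; omega)
      exact Fin.ext (by omega)
    · rintro rfl
      simp
  simp only [hiff]
  split_ifs
  · have : (d : ℂ) ≠ 0 := by exact_mod_cast hd
    field_simp
  · simp

/-- The first condition says `y - x - w + z = d e`. The second then forces `e` even, while `|e| < 2`
by size, so `e = 0`. What remains is `p ∣ 2(y - x)(x - z)`, and `p` is a prime larger than `d`. -/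
theorem phase_dvd_iff {p : ℕ} (hp : p.Prime) (hd : 2 ≤ d) (hdp : d < p) (x y z w : Fin d) :
    (((2 * p * d : ℕ) : ℤ) ∣ 2 * p * ((y : ℤ) - x - w + z) ∧
      ((2 * p * d : ℕ) : ℤ) ∣ ((2 * d * (y : ℤ) ^ 2 + y) - (2 * d * (x : ℤ) ^ 2 + x) -
        (2 * d * (w : ℤ) ^ 2 + w) + (2 * d * (z : ℤ) ^ 2 + z))) ↔
      (x = y ∧ z = w) ∨ (x = z ∧ y = w) := by
  constructor
  · rintro ⟨h1, h2⟩
    have hx := x.2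
    have hy := y.2
    have hz := z.2
    have hw := w.2
    have hd0 : (d : ℤ) ≠ 0 := by omega
    push_cast at h1 h2
    have hp0 : (2 * p : ℤ) ≠ 0 := by have := hp.pos; positivity
    obtain ⟨e, he⟩ : (d : ℤ) ∣ (y : ℤ) - x - w + z := Int.dvd_of_mul_dvd_mul_left hp0 h1
    have h3 : (2 * p : ℤ) * d ∣
        (2 * ((y : ℤ) ^ 2 - (x : ℤ) ^ 2 - (w : ℤ) ^ 2 + (z : ℤ) ^ 2) + e) * d := by
      convert h2 using 1
      linear_combination -he
    have h4 := Int.dvd_of_mul_dvd_mul_right hd0 h3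
    obtain ⟨c, hc⟩ := h4
    have he0 : e = 0 := by
      have h5 : e < 2 := by
        by_contra! hcon
        nlinarith
      have h6 : -2 < e := by
        by_contra! hcon
        nlinarith
      have h7 : e = 2 * (p * c - ((y : ℤ) ^ 2 - (x : ℤ) ^ 2 - (w : ℤ) ^ 2 + (z : ℤ) ^ 2)) := by
        linear_combination hc
      omega
    subst he0
    have h8 : (p : ℤ) ∣ 2 * (((y : ℤ) - x) * ((x : ℤ) - z)) := by
      refine ⟨c, ?_⟩
      have hyw : (w : ℤ) = y - x + z := by linarith
      rw [hyw] at hc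
      linarith
    have hpp : Prime (p : ℤ) := Nat.prime_iff_prime_int.1 hp
    rcases hpp.dvd_or_dvd h8 with h | h
    · have := Int.le_of_dvd (by norm_num) h
      omega
    · rcases hpp.dvd_or_dvd h with h | h
      · have := Int.eq_zero_of_abs_lt_dvd h (by rw [abs_lt]; omega)
        left
        exact ⟨Fin.ext (by omega), Fin.ext (by omega)⟩
      · have := Int.eq_zero_of_abs_lt_dvd h (by rw [abs_lt]; omega)
        right
        exact ⟨Fin.ext (by omega), Fin.ext (by omega)⟩
  · rintro (⟨rfl, rfl⟩ | ⟨rfl, rfl⟩)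
    · refine ⟨⟨0, by ring⟩, ⟨0, by ring⟩⟩
    · refine ⟨⟨0, by ring⟩, ⟨0, by ring⟩⟩

/-- The phase splits into one geometric sum in `k` and one in `a`. When the `k` sum does not vanish,
the exponent of the `a` sum is divisible by `d`, which makes that sum complete too. -/
theorem sum_sum_phase {p : ℕ} (hp : p.Prime) (hd : 2 ≤ d) (hdp : d < p) (x y z w : Fin d) :
    ∑ a : Fin (2 * p), ∑ k : Fin d, rootOfUnity d p ^
      ((phaseExponent d p a k y - phaseExponent d p a k x) -
        (phaseExponent d p a k w - phaseExponent d p a k z)) =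
      if (x = y ∧ z = w) ∨ (x = z ∧ y = w) then (2 * p * d : ℂ) else 0 := by
  have hd0 : d ≠ 0 := by omega
  have hp0 := hp.ne_zero
  set D : ℤ := (2 * d * (y : ℤ) ^ 2 + y) - (2 * d * (x : ℤ) ^ 2 + x) -
        (2 * d * (w : ℤ) ^ 2 + w) + (2 * d * (z : ℤ) ^ 2 + z) with hD
  have e : ∀ (a : Fin (2 * p)) (k : Fin d), rootOfUnity d p ^
      ((phaseExponent d p a k y - phaseExponent d p a k x) -
        (phaseExponent d p a k w - phaseExponent d p a k z)) =
      rootOfUnity d p ^ ((a : ℤ) * D) *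
        rootOfUnity d p ^ ((k : ℤ) * (2 * p * ((y : ℤ) - x - w + z))) := by
    intro a k
    rw [← zpow_add₀ (rootOfUnity_ne_zero d p)]
    congr 1
    simp only [phaseExponent, hD]
    ring
  simp only [e, ← Finset.mul_sum, ← Finset.sum_mul]
  rw [sum_rootOfUnity_zpow hd0 hp0 d _ ⟨(y : ℤ) - x - w + z, by push_cast; ring⟩]
  have hiff := phase_dvd_iff hp hd hdp x y z w
  rw [← hD] at hiff
  by_cases h1 : ((2 * p * d : ℕ) : ℤ) ∣ 2 * p * ((y : ℤ) - x - w + z)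
  · rw [if_pos h1]
    have h2 : ((2 * p * d : ℕ) : ℤ) ∣ ((2 * p : ℕ) : ℤ) * D := by
      push_cast at h1 ⊢
      have h3 : (d : ℤ) ∣ (y : ℤ) - x - w + z :=
        Int.dvd_of_mul_dvd_mul_left (by positivity) h1
      refine mul_dvd_mul_left _ ?_
      obtain ⟨c, hc⟩ := h3
      refine ⟨2 * ((y : ℤ) ^ 2 - (x : ℤ) ^ 2 - (w : ℤ) ^ 2 + (z : ℤ) ^ 2) + c, ?_⟩
      rw [hD]
      linear_combination hc
    rw [sum_rootOfUnity_zpow hd0 hp0 (2 * p) _ h2]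
    simp only [← hiff, h1, true_and]
    split_ifs
    · push_cast; ring
    · simp
  · rw [if_neg h1, mul_zero, if_neg]
    rw [← hiff]
    exact fun h => h1 h.1

/-- For `x = y` the pairing leaves the conjugate trace of `T`, which vanishes; otherwise it selects
the single entry `(x, y)`. -/
theorem sum_star_mul_phase_indicator {T : Matrix (Fin d) (Fin d) ℂ} (hT0 : T.trace = 0)
    (x y : Fin d) :
    ∑ z, ∑ w, star (T z w) * (if (x = y ∧ z = w) ∨ (x = z ∧ y = w) then (1 : ℂ) else 0) =
      if x = y then 0 else star (T x y) := by
  split_ifs with h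
  · subst h
    have h1 : ∀ z w : Fin d, ((x = x ∧ z = w) ∨ (x = z ∧ x = w)) ↔ z = w := by
      intro z w
      exact ⟨fun h => h.elim And.right fun h => h.1.symm.trans h.2, fun h => Or.inl ⟨rfl, h⟩⟩
    have h2 : ∀ z : Fin d, ∑ w, star (T z w) *
        (if (x = x ∧ z = w) ∨ (x = z ∧ x = w) then (1 : ℂ) else 0) = star (T z z) := by
      intro z
      rw [Finset.sum_congr rfl fun w _ => by rw [if_congr (h1 z w) rfl rfl]]
      simp
    rw [Finset.sum_congr rfl fun z _ => h2 z, ← star_sum]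
    change star T.trace = 0
    rw [hT0, star_zero]
  · rw [Finset.sum_eq_single x, Finset.sum_eq_single y]
    · simp
    · intro w _ hw
      simp [h, Ne.symm hw]
    · simp
    · intro z _ hz
      exact Finset.sum_eq_zero fun w _ => by simp [h, Ne.symm hz]
    · simp

theorem ofReal_re_sq_eq {z : ℂ} (h : (z.re : ℂ) = z) : ((z.re ^ 2 : ℝ) : ℂ) = z * star z := by
  obtain ⟨r, rfl⟩ : ∃ r : ℝ, z = r := ⟨z.re, h.symm⟩
  simp [sq]

/-- Expanding the squared expectations gives a quartic sum over indices, in which the phase sums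
keep only the pairings `x = y, z = w` and `x = z, y = w`. -/
theorem sum_diagWeight_phaseMatrix {p : ℕ} (hp : p.Prime) (hd : 2 ≤ d) (hdp : d < p)
    {T : Matrix (Fin d) (Fin d) ℂ} (hT : T.IsHermitian) (hT0 : T.trace = 0) :
    ∑ a : Fin (2 * p), diagWeight (phaseMatrix d p a) T =
      2 * p / d * ∑ x, ∑ y, if x = y then 0 else Complex.normSq (T x y) := by
  have hd0 : d ≠ 0 := by omega
  have hdC : (d : ℂ) ≠ 0 := by exact_mod_cast hd0
  let G : (Fin d × Fin d) × (Fin d × Fin d) → Fin (2 * p) → Fin d → ℂ := fun q a k =>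
    rootOfUnity d p ^ ((phaseExponent d p a k q.1.2 - phaseExponent d p a k q.1.1) -
      (phaseExponent d p a k q.2.2 - phaseExponent d p a k q.2.1))
  have h1 : ∀ (a : Fin (2 * p)) (k : Fin d),
      (((colState (phaseMatrix d p a) k * T).trace.re ^ 2 : ℝ) : ℂ) =
        ∑ q : (Fin d × Fin d) × (Fin d × Fin d),
          (1 / d : ℂ) ^ 2 * (T q.1.1 q.1.2 * star (T q.2.1 q.2.2)) * G q a k := by
    intro a k
    rw [ofReal_re_sq_eq (trace_mul_eq_ofReal_re (colState_isHermitian (phaseMatrix d p a) k) hT),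
      trace_colState_mul, ← Fintype.sum_prod_type', star_sum, Finset.sum_mul_sum,
      ← Fintype.sum_prod_type']
    refine Finset.sum_congr rfl fun q _ => ?_
    have : star (1 / d : ℂ) = 1 / d := by simp
    simp only [star_phaseMatrix_mul hd0, star_mul', star_rootOfUnity_zpow, G, this]
    rw [sub_eq_add_neg _ (phaseExponent d p a k q.2.2 - phaseExponent d p a k q.2.1),
      zpow_add₀ (rootOfUnity_ne_zero d p)]
    ring
  have h3 : ((∑ a : Fin (2 * p), diagWeight (phaseMatrix d p a) T : ℝ) : ℂ) =
      ∑ q : (Fin d × Fin d) × (Fin d × Fin d),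
        (1 / d : ℂ) ^ 2 * (T q.1.1 q.1.2 * star (T q.2.1 q.2.2)) *
          ∑ a, ∑ k, G q a k := by
    simp only [diagWeight, Complex.ofReal_sum, h1, Finset.mul_sum]
    exact (Finset.sum_congr rfl fun a _ => Finset.sum_comm).trans Finset.sum_comm
  have h4 : ((∑ a : Fin (2 * p), diagWeight (phaseMatrix d p a) T : ℝ) : ℂ) =
      (2 * p / d : ℂ) * ∑ x, ∑ y, T x y * ∑ z, ∑ w, star (T z w) *
        (if (x = y ∧ z = w) ∨ (x = z ∧ y = w) then (1 : ℂ) else 0) := by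
    rw [h3]
    simp only [Fintype.sum_prod_type, G, sum_sum_phase hp hd hdp, Finset.mul_sum]
    refine Finset.sum_congr rfl fun x _ => ?_
    refine Finset.sum_congr rfl fun y _ => ?_
    refine Finset.sum_congr rfl fun z _ => ?_
    refine Finset.sum_congr rfl fun w _ => ?_
    split_ifs
    · field_simp
    · simp
  apply Complex.ofReal_injective
  rw [h4]
  simp only [sum_star_mul_phase_indicator hT0]
  push_cast
  congr 1
  refine Finset.sum_congr rfl fun x _ => Finset.sum_congr rfl fun y _ => ?_
  split_ifs
  · simp
  · rw [← Complex.mul_conj]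
    rfl

theorem trace_mul_self_re_eq {T : Matrix (Fin d) (Fin d) ℂ} (hT : T.IsHermitian) :
    (T * T).trace.re = ∑ k, (T k k).re ^ 2 +
      ∑ x, ∑ y, if x = y then 0 else Complex.normSq (T x y) := by
  have h1 : (T * T).trace = ((∑ x, ∑ y, Complex.normSq (T x y) : ℝ) : ℂ) := by
    simp only [Matrix.trace, Matrix.diag_apply, Matrix.mul_apply, Complex.ofReal_sum]
    refine Finset.sum_congr rfl fun x _ => Finset.sum_congr rfl fun y _ => ?_
    rw [← Complex.mul_conj]
    congr 1
    exact (hT.apply y x).symm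
  rw [h1, Complex.ofReal_re, ← Finset.sum_add_distrib]
  refine Finset.sum_congr rfl fun x _ => ?_
  rw [← Finset.add_sum_erase _ _ (Finset.mem_univ x),
    ← Finset.add_sum_erase _ (fun y => if x = y then 0 else Complex.normSq (T x y))
      (Finset.mem_univ x), if_pos rfl, zero_add]
  congr 1
  · have him : (T x x).im = 0 := by
      have := congrArg Complex.im (hT.apply x x)
      simp only [RCLike.star_def, Complex.conj_im] at this
      linarith
    rw [Complex.normSq_apply, him]
    ring
  · refine Finset.sum_congr rfl fun y hy => ?_
    rw [if_neg (Finset.ne_of_mem_erase hy).symm]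

/-! #### Cyclic repetition -/

theorem sum_range_mod_mul (F : ℕ → ℝ) (q c : ℕ) :
    ∑ j ∈ Finset.range (q * c), F (j % q) = c * ∑ j ∈ Finset.range q, F j := by
  induction c with
  | zero => simp
  | succ c ih =>
    rw [Nat.mul_succ, Finset.sum_range_add, ih]
    have : ∀ j ∈ Finset.range q, F ((q * c + j) % q) = F j := by
      intro j hj
      rw [Nat.mul_add_mod, Nat.mod_eq_of_lt (Finset.mem_range.1 hj)]
    rw [Finset.sum_congr rfl this]
    push_cast
    ring

/-- Compare `L` with the neighbouring multiples of `q`: an incomplete cycle costs at most one full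
period. -/
theorem sum_range_mod_bounds {F : ℕ → ℝ} (hF : ∀ j, 0 ≤ F j) {q : ℕ} (hq : 0 < q) (L : ℕ) :
    ((L : ℝ) - q) * ∑ j ∈ Finset.range q, F j ≤ q * ∑ j ∈ Finset.range L, F (j % q) ∧
      q * ∑ j ∈ Finset.range L, F (j % q) ≤ ((L : ℝ) + q) * ∑ j ∈ Finset.range q, F j := by
  have hS : 0 ≤ ∑ j ∈ Finset.range q, F j := Finset.sum_nonneg fun j _ => hF j
  have hq0 : (0 : ℝ) ≤ q := Nat.cast_nonneg q
  have hdm : q * (L / q) + L % q = L := Nat.div_add_mod L q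
  have hlt : L % q < q := Nat.mod_lt L hq
  have hR : (q : ℝ) * (L / q : ℕ) + (L % q : ℕ) = L := by exact_mod_cast hdm
  have hlt' : ((L % q : ℕ) : ℝ) ≤ q := by exact_mod_cast hlt.le
  have hmono : ∀ {a b : ℕ}, a ≤ b →
      ∑ j ∈ Finset.range a, F (j % q) ≤ ∑ j ∈ Finset.range b, F (j % q) := fun hab =>
    Finset.sum_le_sum_of_subset_of_nonneg (Finset.range_mono hab) fun _ _ _ => hF _
  constructor
  · calc ((L : ℝ) - q) * ∑ j ∈ Finset.range q, F j
        ≤ (q * (L / q : ℕ)) * ∑ j ∈ Finset.range q, F j := by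
          gcongr
          linarith
      _ = q * ∑ j ∈ Finset.range (q * (L / q)), F (j % q) := by
          rw [sum_range_mod_mul]
          ring
      _ ≤ _ := by
          gcongr q * ?_
          exact hmono (by omega)
  · calc (q : ℝ) * ∑ j ∈ Finset.range L, F (j % q)
        ≤ q * ∑ j ∈ Finset.range (q * (L / q + 1)), F (j % q) := by
          gcongr q * ?_
          exact hmono (by rw [Nat.mul_succ]; omega)
      _ = (q * (L / q : ℕ) + q) * ∑ j ∈ Finset.range q, F j := by
          rw [sum_range_mod_mul]
          push_cast
          ring
      _ ≤ _ := by
          gcongr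
          have : (0 : ℝ) ≤ (L % q : ℕ) := Nat.cast_nonneg _
          linarith

end ExplicitDesign

/-! ### Existence of approximate designs above the threshold. -/

section ApproximateDesign

variable {d : ℕ}

/-- The average over the bases `U b` of the projections on their diagonal subspaces is between `lo`
and `hi` on the traceless selfadjoint matrices. -/
def IsApproxDesign {m : ℕ} (U : Fin m → Matrix.unitaryGroup (Fin d) ℂ) (lo hi : ℝ) : Prop :=
  ∀ T : Matrix (Fin d) (Fin d) ℂ, T.IsHermitian → T.trace = 0 →
    lo * m * (T * T).trace.re ≤ ∑ b, diagWeight (U b) T ∧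
      ∑ b, diagWeight (U b) T ≤ hi * m * (T * T).trace.re

/-- Here `R = m/(d+1)`, `a` counts the copies of the standard basis, `q = 2p` is the cycle length,
`g` and `f` are the diagonal and off-diagonal parts of `tr T²`, and `S` is the phase weight. The two
parts are compared separately; the rounding losses, `1` in `a` and `q ≤ 4d` in the cycle, are
absorbed by `ε R ≥ 38/5`. -/
theorem weight_lower_bound {d ε R a q S f g : ℝ} (hd : 1 ≤ d) (hε : 0 < ε) (hε2 : ε ≤ 1 / 2)
    (hRε : 38 / 5 ≤ ε * R) (ha : R - 1 ≤ a) (ha' : a ≤ R) (hq : q ≤ 4 * d) (hf : 0 ≤ f)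
    (hg : 0 ≤ g) (h : (R * (d + 1) - a - q) * f ≤ d * S) :
    R * (g + f) ≤ (a * g + S) * (1 + ε) := by
  have hd0 : 0 < d := by linarith
  have h1 : R ≤ a * (1 + ε) := by
    have := mul_le_mul_of_nonneg_right ha (by linarith : 0 ≤ 1 + ε)
    linarith
  have h2 : d * R ≤ (R * (d + 1) - a - q) * (1 + ε) := by
    have h3 : d * R - 4 * d ≤ R * (d + 1) - a - q := by linarith
    have h4 : 0 ≤ d * (ε * R - 4 - 4 * ε) := mul_nonneg hd0.le (by linarith)
    have h5 := mul_le_mul_of_nonneg_right h3 (by linarith : 0 ≤ 1 + ε)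
    linarith
  have h6 : d * (R * f) ≤ d * (S * (1 + ε)) := by
    have h7 := mul_le_mul_of_nonneg_right h2 hf
    have h8 := mul_le_mul_of_nonneg_right h (by linarith : 0 ≤ 1 + ε)
    linarith
  have h9 := le_of_mul_le_mul_left h6 hd0
  have h10 := mul_le_mul_of_nonneg_right h1 hg
  linarith

theorem weight_upper_bound {d ε R a q S f g : ℝ} (hd : 1 ≤ d) (hε : 0 < ε) (hε2 : ε ≤ 1 / 2)
    (hRε : 38 / 5 ≤ ε * R) (ha : R - 1 ≤ a) (ha' : a ≤ R) (hq : q ≤ 4 * d) (hf : 0 ≤ f)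
    (hg : 0 ≤ g) (h : d * S ≤ (R * (d + 1) - a + q) * f) :
    (a * g + S) * (1 - ε) ≤ R * (g + f) := by
  have hd0 : 0 < d := by linarith
  have hε1 : 0 ≤ 1 - ε := by linarith
  have h1 : a * (1 - ε) ≤ R := by
    have := mul_le_mul_of_nonneg_right ha' hε1
    linarith
  have h2 : (R * (d + 1) - a + q) * (1 - ε) ≤ d * R := by
    have h3 : R * (d + 1) - a + q ≤ d * R + 5 * d := by linarith
    have h4 : 0 ≤ d * (ε * R - 5 + 5 * ε) := mul_nonneg hd0.le (by linarith)
    have h5 := mul_le_mul_of_nonneg_right h3 hε1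
    linarith
  have h6 : d * (S * (1 - ε)) ≤ d * (R * f) := by
    have h7 := mul_le_mul_of_nonneg_right h2 hf
    have h8 := mul_le_mul_of_nonneg_right h hε1
    linarith
  have h9 := le_of_mul_le_mul_left h6 hd0
  have h10 := mul_le_mul_of_nonneg_right h1 hg
  linarith

/-- The ideal constant is `1/(d+1)`; the factors `1/(1 ± ε)` are chosen so that inverting `H`
produces exactly `1 ± ε`. -/
theorem exists_isApproxDesign (hd : 2 ≤ d) {ε : ℝ} {m : ℕ} (hε : 0 < ε) (hε2 : ε ≤ 1 / 2)
    (hm : 38 / 10 * ((d : ℝ) + 1) ≤ ε ^ 2 * m) :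
    ∃ U : Fin m → Matrix.unitaryGroup (Fin d) ℂ,
      IsApproxDesign U (1 / ((1 + ε) * (d + 1))) (1 / ((1 - ε) * (d + 1))) := by
  -- Bertrand's postulate keeps the cycle length `2p` at most `4d`.
  obtain ⟨p, hp, hdp, hpd⟩ := Nat.exists_prime_lt_and_le_two_mul d (by omega)
  have hd0 : d ≠ 0 := by omega
  have hdR : (2 : ℝ) ≤ d := by exact_mod_cast hd
  have hpR : (p : ℝ) ≤ 2 * d := by exact_mod_cast hpd
  -- A fraction `1/(d+1)` of standard bases, the rest being phase bases of average weight `f/d`,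
  -- gives both parts the weight `m/(d+1)`.
  let m₀ := m / (d + 1)
  have hm₀ : m₀ ≤ m := Nat.div_le_self _ _
  let U : ℕ → Matrix.unitaryGroup (Fin d) ℂ := fun b =>
    if b < m₀ then 1 else ⟨phaseMatrix d p ((b - m₀) % (2 * p)),
      phaseMatrix_mem_unitaryGroup hd0 hp.ne_zero _⟩
  refine ⟨fun b => U b, fun T hT hT0 => ?_⟩
  set F : ℕ → ℝ := fun a => diagWeight (phaseMatrix d p a) T with hF
  set g : ℝ := ∑ k, (T k k).re ^ 2 with hg
  set f : ℝ := ∑ x, ∑ y, if x = y then 0 else Complex.normSq (T x y) with hf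
  have hg0 : 0 ≤ g := Finset.sum_nonneg fun _ _ => sq_nonneg _
  have hf0 : 0 ≤ f := Finset.sum_nonneg fun _ _ => Finset.sum_nonneg fun _ _ => by
    split_ifs
    · exact le_rfl
    · exact Complex.normSq_nonneg _
  have hsum : ∑ b : Fin m, diagWeight (U b : Matrix (Fin d) (Fin d) ℂ) T =
      m₀ * g + ∑ j ∈ Finset.range (m - m₀), F (j % (2 * p)) := by
    rw [Fin.sum_univ_eq_sum_range (fun b => diagWeight (U b : Matrix (Fin d) (Fin d) ℂ) T) m]
    conv_lhs => rw [← Nat.add_sub_cancel' hm₀]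
    rw [Finset.sum_range_add]
    congr 1
    · rw [Finset.sum_congr rfl (g := fun _ => g), Finset.sum_const, Finset.card_range,
        nsmul_eq_mul]
      intro b hb
      simp only [U, if_pos (Finset.mem_range.1 hb)]
      exact diagWeight_one T
    · refine Finset.sum_congr rfl fun j _ => ?_
      simp [U, hF]
  have hF1 : ∑ j ∈ Finset.range (2 * p), F j = 2 * p / d * f := by
    rw [← Fin.sum_univ_eq_sum_range F (2 * p)]
    exact sum_diagWeight_phaseMatrix hp hd hdp hT hT0
  have hb := sum_range_mod_bounds (F := F) (fun j => diagWeight_nonneg _ _)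
    (q := 2 * p) (by have := hp.pos; omega) (m - m₀)
  rw [hF1] at hb
  set S := ∑ j ∈ Finset.range (m - m₀), F (j % (2 * p)) with hS
  have hp0 : (0 : ℝ) < 2 * p := by have := hp.pos; positivity
  have hL : ((m - m₀ : ℕ) : ℝ) = m - m₀ := Nat.cast_sub hm₀
  push_cast at hb
  rw [hL] at hb
  have hlo : ((m : ℝ) - m₀ - 2 * p) * f ≤ d * S := by
    have h1 := hb.1
    have h2 : ((m : ℝ) - m₀ - 2 * p) * (2 * p / d * f) =
        2 * p * (((m : ℝ) - m₀ - 2 * p) * f / d) := by ring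
    rw [h2] at h1
    have h3 := le_of_mul_le_mul_left h1 hp0
    rwa [div_le_iff₀ (by positivity), mul_comm S] at h3
  have hhi : d * S ≤ ((m : ℝ) - m₀ + 2 * p) * f := by
    have h1 := hb.2
    have h2 : ((m : ℝ) - m₀ + 2 * p) * (2 * p / d * f) =
        2 * p * (((m : ℝ) - m₀ + 2 * p) * f / d) := by ring
    rw [h2] at h1
    have h3 := le_of_mul_le_mul_left h1 hp0
    rwa [le_div_iff₀ (by positivity), mul_comm S] at h3
  set R : ℝ := m / (d + 1) with hR
  have hmR : (m : ℝ) = R * (d + 1) := by rw [hR]; field_simp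
  have hRε : 38 / 5 ≤ ε * R := by
    have h1 : 38 / 10 ≤ ε * (ε * R) := by
      rw [hR, ← mul_assoc, ← sq, ← mul_div_assoc, le_div_iff₀ (by positivity)]
      exact hm
    -- From `ε² R ≥ 38/10` and `ε ≤ 1/2`.
    by_contra! hc
    have h2 : ε * (ε * R) < ε * (38 / 5) := mul_lt_mul_of_pos_left hc hε
    linarith
  have hm₀R : (m₀ : ℝ) ≤ R := by
    have := Nat.cast_div_le (α := ℝ) (m := m) (n := d + 1)
    push_cast at this
    exact this
  have hm₀R' : R - 1 ≤ m₀ := by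
    have h1 : m < (m₀ + 1) * (d + 1) := by
      have := Nat.lt_div_mul_add (a := m) (b := d + 1) (by omega)
      calc m < m₀ * (d + 1) + (d + 1) := this
        _ = _ := by ring
    have h2 : (m : ℝ) < (m₀ + 1) * (d + 1) := by exact_mod_cast h1
    rw [hmR] at h2
    have h3 := lt_of_mul_lt_mul_right h2 (by positivity)
    linarith
  have hR0 : 0 < R := by
    by_contra! hc
    linarith [mul_nonpos_of_nonneg_of_nonpos hε.le hc]
  rw [hsum, trace_mul_self_re_eq hT, ← hg, ← hf, hmR]
  have hε1 : 0 < 1 - ε := by linarith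
  have e1 : 1 / ((1 + ε) * ((d : ℝ) + 1)) * (R * (d + 1)) * (g + f) = R * (g + f) / (1 + ε) := by
    field_simp
  have e2 : 1 / ((1 - ε) * ((d : ℝ) + 1)) * (R * (d + 1)) * (g + f) = R * (g + f) / (1 - ε) := by
    field_simp
  rw [e1, e2, div_le_iff₀ (by positivity), le_div_iff₀ hε1]
  rw [hmR] at hlo hhi
  have hq : (2 : ℝ) * p ≤ 4 * d := by linarith
  exact ⟨weight_lower_bound (by linarith) hε hε2 hRε hm₀R' hm₀R hq hf0 hg0 hlo,
    weight_upper_bound (by linarith) hε hε2 hRε hm₀R' hm₀R hq hf0 hg0 hhi⟩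

/-- Since `2(d² - 1) ≥ 4`, the logarithmic factors give at least `8 (ln 2)² > 3.8`; this is all that
is used of the threshold. -/
theorem threshold_le (hd : 2 ≤ d) {ε : ℝ} {m : ℕ} (hε : 0 < ε)
    (hm : 4 * ((d : ℝ) + 1) * Real.log 2 / ε ^ 2 * Real.log (2 * ((d : ℝ) ^ 2 - 1)) < m) :
    38 / 10 * ((d : ℝ) + 1) ≤ ε ^ 2 * m := by
  have hdR : (2 : ℝ) ≤ d := by exact_mod_cast hd
  have hl := Real.log_two_gt_d9
  have h1 : 2 * Real.log 2 ≤ Real.log (2 * ((d : ℝ) ^ 2 - 1)) := by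
    have : 2 * Real.log 2 = Real.log (2 ^ 2) := by rw [Real.log_pow]; norm_num
    rw [this]
    exact Real.log_le_log (by norm_num) (by nlinarith)
  have h2 : ε ^ 2 * (4 * ((d : ℝ) + 1) * Real.log 2 / ε ^ 2 * Real.log (2 * ((d : ℝ) ^ 2 - 1))) ≤
      ε ^ 2 * m := by gcongr
  have h3 : ε ^ 2 * (4 * ((d : ℝ) + 1) * Real.log 2 / ε ^ 2 *
      Real.log (2 * ((d : ℝ) ^ 2 - 1))) =
      4 * ((d : ℝ) + 1) * (Real.log 2 * Real.log (2 * ((d : ℝ) ^ 2 - 1))) := by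
    field_simp
  rw [h3] at h2
  refine le_trans ?_ h2
  have h4 : 0.69 * (2 * 0.69) ≤ Real.log 2 * Real.log (2 * ((d : ℝ) ^ 2 - 1)) := by
    gcongr <;> linarith
  nlinarith

end ApproximateDesign

/-! ### The approximate-design input state -/

section DesignState

variable {d n m : ℕ}

theorem sum_colState (U : Matrix.unitaryGroup (Fin d) ℂ) :
    ∑ k, colState (U : Matrix (Fin d) (Fin d) ℂ) k = 1 := by
  rw [← Matrix.mem_unitaryGroup_iff.1 U.2]
  ext x y
  simp [Matrix.sum_apply, colState, Matrix.vecMulVec_apply, Matrix.mul_apply, Matrix.star_apply]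

theorem trace_colState (U : Matrix.unitaryGroup (Fin d) ℂ) (k : Fin d) :
    (colState (U : Matrix (Fin d) (Fin d) ℂ) k).trace = 1 := by
  have h := congrFun (congrFun (Matrix.mem_unitaryGroup_iff'.1 U.2) k) k
  rw [Matrix.mul_apply, Matrix.one_apply_eq] at h
  rw [← h, colState, Matrix.trace_vecMulVec, dotProduct_comm]
  rfl

theorem sum_trace_colState_mul (U : Matrix.unitaryGroup (Fin d) ℂ) (T : Matrix (Fin d) (Fin d) ℂ) :
    ∑ k, (colState (U : Matrix (Fin d) (Fin d) ℂ) k * T).trace = T.trace := by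
  rw [← Matrix.trace_sum, ← Finset.sum_mul, sum_colState, Matrix.one_mul]

/-- The orthonormal ancilla labels `|bk⟩` destroy interference between different `(b, k)`, leaving a
uniform mixture of product states. -/
theorem trace_designState_mul (U : Fin m → Matrix.unitaryGroup (Fin d) ℂ)
    (Z : Matrix (Fin n → Fin d) (Fin n → Fin d) ℂ) :
    (designState n U * ((1 : Matrix (Fin m × Fin d) (Fin m × Fin d) ℂ) ⊗ₖ Z)).trace =
      (1 / (m * d) : ℂ) * ∑ b, ∑ k,
        (tensorPow n (colState (U b : Matrix (Fin d) (Fin d) ℂ) k) * Z).trace := by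
  have hs : (((1 / Real.sqrt ((m : ℝ) * d) : ℝ) : ℂ)) * ((1 / Real.sqrt ((m : ℝ) * d) : ℝ) : ℂ) =
      1 / (m * d) := by
    rw [← Complex.ofReal_mul, div_mul_div_comm, Real.mul_self_sqrt (by positivity)]
    simp
  have hstar : star (((1 / Real.sqrt ((m : ℝ) * d) : ℝ) : ℂ)) =
      ((1 / Real.sqrt ((m : ℝ) * d) : ℝ) : ℂ) := Complex.conj_ofReal _
  rw [designState, Matrix.trace_mul_comm, trace_mul_vecMulVec_star]
  simp only [dotProduct, Matrix.mulVec, Pi.star_apply, Matrix.kroneckerMap_apply,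
    Fintype.sum_prod_type (α₂ := Fin n → Fin d), Matrix.one_apply, ite_mul, one_mul, zero_mul]
  rw [Fintype.sum_prod_type, Finset.mul_sum]
  refine Finset.sum_congr rfl fun b _ => ?_
  rw [Finset.mul_sum]
  refine Finset.sum_congr rfl fun k _ => ?_
  rw [Matrix.trace_mul_comm, Matrix.trace, Finset.mul_sum]
  refine Finset.sum_congr rfl fun f _ => ?_
  rw [Finset.sum_eq_single (b, k), Matrix.diag_apply, Matrix.mul_apply, Finset.mul_sum,
    Finset.mul_sum]
  · refine Finset.sum_congr rfl fun g _ => ?_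
    simp only [if_true, designVector, star_mul', hstar, star_prod, tensorPow, Matrix.of_apply,
      colState, Matrix.vecMulVec_apply, Pi.star_apply, Finset.prod_mul_distrib]
    rw [← hs]
    ring
  · intro c _ hc
    simp [Ne.symm hc]
  · simp

theorem isDensityMatrix_designState (hd : 0 < d) (hm : 0 < m)
    (U : Fin m → Matrix.unitaryGroup (Fin d) ℂ) : IsDensityMatrix (designState n U) := by
  refine ⟨Matrix.posSemidef_vecMulVec_self_star _, ?_⟩
  have h := trace_designState_mul U (1 : Matrix (Fin n → Fin d) (Fin n → Fin d) ℂ)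
  rw [Matrix.one_kronecker_one, Matrix.mul_one] at h
  rw [h]
  have hd0 : (d : ℂ) ≠ 0 := by exact_mod_cast hd.ne'
  have hm0 : (m : ℂ) ≠ 0 := by exact_mod_cast hm.ne'
  simp only [trace_tensorPow (trace_colState _ _), Finset.sum_const,
    Finset.card_univ, Fintype.card_fin, nsmul_eq_mul, mul_one]
  field_simp

theorem trace_designState_mul_collective (U : Fin m → Matrix.unitaryGroup (Fin d) ℂ)
    {t : Matrix (Fin d) (Fin d) ℂ} (ht : t.trace = 0) :
    (designState n U * collective (Fin m × Fin d) n t).trace = 0 := by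
  rw [collective, trace_designState_mul]
  simp [trace_tensorPow_mul_siteSum (trace_colState _ _), ← Finset.mul_sum,
    sum_trace_colState_mul, ht]

theorem trace_designState_mul_collective_mul (hm : 0 < m)
    (U : Fin m → Matrix.unitaryGroup (Fin d) ℂ) (s t : Matrix (Fin d) (Fin d) ℂ) :
    (designState n U * (collective (Fin m × Fin d) n s * collective (Fin m × Fin d) n t)).trace =
      n / d * (s * t).trace + n * (n - 1) / (m * d) * ∑ b, ∑ k,
        (colState (U b : Matrix (Fin d) (Fin d) ℂ) k * s).trace *
          (colState (U b : Matrix (Fin d) (Fin d) ℂ) k * t).trace := by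
  have hm0 : (m : ℂ) ≠ 0 := by exact_mod_cast hm.ne'
  rw [collective_mul_collective, trace_designState_mul]
  simp only [trace_tensorPow_mul_siteSum_mul_siteSum (trace_colState _ _), Finset.sum_add_distrib,
    ← Finset.mul_sum, sum_trace_colState_mul, Finset.sum_const, Finset.card_univ, Fintype.card_fin,
    nsmul_eq_mul]
  field_simp

/-- The quantum Fisher information matrix of the approximate-design state. -/
def designQFI (n : ℕ) (U : Fin m → Matrix.unitaryGroup (Fin d) ℂ)
    (t : Fin (d ^ 2 - 1) → Matrix (Fin d) (Fin d) ℂ) :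
    Matrix (Fin (d ^ 2 - 1)) (Fin (d ^ 2 - 1)) ℝ :=
  Matrix.of fun α β => 4 * (n / d * (if α = β then 1 else 0) + n * (n - 1) / (m * d) * ∑ b, ∑ k,
    (colState (U b : Matrix (Fin d) (Fin d) ℂ) k * t α).trace.re *
      (colState (U b : Matrix (Fin d) (Fin d) ℂ) k * t β).trace.re)

theorem designQFI_isHermitian (U : Fin m → Matrix.unitaryGroup (Fin d) ℂ)
    (t : Fin (d ^ 2 - 1) → Matrix (Fin d) (Fin d) ℂ) : (designQFI n U t).IsHermitian := by
  ext α β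
  simp only [designQFI, Matrix.conjTranspose_apply, Matrix.of_apply, star_trivial, mul_comm,
    eq_comm]

variable {t : Fin (d ^ 2 - 1) → Matrix (Fin d) (Fin d) ℂ}

theorem IsTracelessBasis.trace_sum_smul_mul_self (ht : IsTracelessBasis t)
    (c : Fin (d ^ 2 - 1) → ℝ) :
    ((∑ α, (c α : ℂ) • t α) * ∑ α, (c α : ℂ) • t α).trace.re = c ⬝ᵥ c := by
  have : ((∑ α, (c α : ℂ) • t α) * ∑ α, (c α : ℂ) • t α).trace = ((c ⬝ᵥ c : ℝ) : ℂ) := by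
    simp [Finset.sum_mul, Finset.mul_sum, Matrix.trace_sum, ht.trace_mul, dotProduct]
  rw [this, Complex.ofReal_re]

theorem designQFI_quadForm (U : Fin m → Matrix.unitaryGroup (Fin d) ℂ)
    (c : Fin (d ^ 2 - 1) → ℝ) :
    c ⬝ᵥ (designQFI n U t *ᵥ c) = 4 * (n / d * (c ⬝ᵥ c) + n * (n - 1) / (m * d) *
      ∑ b, diagWeight (U b : Matrix (Fin d) (Fin d) ℂ) (∑ α, (c α : ℂ) • t α)) := by
  have h1 : ∀ b k, (colState (U b : Matrix (Fin d) (Fin d) ℂ) k *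
      ∑ α, (c α : ℂ) • t α).trace.re =
      ∑ α, c α * (colState (U b : Matrix (Fin d) (Fin d) ℂ) k * t α).trace.re := by
    intro b k
    rw [Finset.mul_sum, Matrix.trace_sum, Complex.re_sum]
    refine Finset.sum_congr rfl fun α _ => ?_
    rw [Matrix.mul_smul, Matrix.trace_smul, smul_eq_mul, Complex.re_ofReal_mul]
  have h2 : ∑ b, diagWeight (U b : Matrix (Fin d) (Fin d) ℂ) (∑ α, (c α : ℂ) • t α) =
      ∑ α, ∑ β, c α * c β * ∑ b, ∑ k, (colState (U b : Matrix (Fin d) (Fin d) ℂ) k * t α).trace.re *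
        (colState (U b : Matrix (Fin d) (Fin d) ℂ) k * t β).trace.re := by
    simp only [diagWeight, h1]
    simp only [sq, Finset.sum_mul_sum, ← Fintype.sum_prod_type', Finset.mul_sum
      (s := Finset.univ (α := Fin m × Fin d))]
    refine Fintype.sum_equiv ⟨fun x => (x.2.2.1, x.2.2.2, x.1, x.2.1),
      fun x => (x.2.2.1, x.2.2.2, x.1, x.2.1), fun _ => rfl, fun _ => rfl⟩ _ _ fun x => ?_
    simp only [Equiv.coe_fn_mk]
    ring
  have h3 : c ⬝ᵥ c = ∑ α, ∑ β, c α * c β * if α = β then 1 else 0 := by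
    simp [dotProduct]
  rw [h2, h3]
  simp only [dotProduct, Matrix.mulVec, designQFI, Matrix.of_apply, Finset.mul_sum (s := Finset.univ
    (α := Fin (d ^ 2 - 1))), ← Finset.sum_add_distrib]
  refine Finset.sum_congr rfl fun α _ => Finset.sum_congr rfl fun β _ => ?_
  ring

/-- The scalar in `optimalQFI`. -/
def optimalScalar (d n : ℕ) : ℝ := 4 * (n : ℝ) * (n + d) / (d * (d + 1))

theorem optimalScalar_pos (hd : 2 ≤ d) (hn : 1 ≤ n) : 0 < optimalScalar d n := by
  have : (0 : ℝ) < d := by exact_mod_cast (by omega : 0 < d)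
  have : (0 : ℝ) < n := by exact_mod_cast hn
  unfold optimalScalar
  positivity

theorem optimalQFI_inv (hd : 2 ≤ d) (hn : 1 ≤ n) :
    (optimalQFI d n)⁻¹ = (optimalScalar d n)⁻¹ • 1 := by
  refine Matrix.inv_eq_right_inv ?_
  change (optimalScalar d n • (1 : Matrix _ _ ℝ)) * _ = 1
  rw [Matrix.smul_mul, Matrix.one_mul, smul_smul, mul_inv_cancel₀ (optimalScalar_pos hd hn).ne',
    one_smul]

theorem card_mul_inv_optimalScalar (hd : 2 ≤ d) (hn : 1 ≤ n) :
    (optimalScalar d n)⁻¹ * (d ^ 2 - 1 : ℕ) = optimalCost d n := by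
  have : (0 : ℝ) < d := by exact_mod_cast (by omega : 0 < d)
  have : (0 : ℝ) < n := by exact_mod_cast hn
  rw [cast_sq_sub_one hd, optimalScalar, optimalCost]
  field_simp
  ring

/-- Only the pair term depends on the design; the term `n/d` is exact and is merely relaxed by `1/(1
± ε)`. Ideally `n/d + n(n-1)/(d(d+1)) = n(n+d)/(d(d+1))`. -/
theorem designQFI_quadForm_bounds (hd : 2 ≤ d) (hn : 1 ≤ n) (hm : 0 < m)
    (ht : IsTracelessBasis t) {ε : ℝ} (hε : 0 < ε) (hε2 : ε ≤ 1 / 2)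
    {U : Fin m → Matrix.unitaryGroup (Fin d) ℂ}
    (hU : IsApproxDesign U (1 / ((1 + ε) * (d + 1))) (1 / ((1 - ε) * (d + 1))))
    (c : Fin (d ^ 2 - 1) → ℝ) :
    optimalScalar d n / (1 + ε) * (c ⬝ᵥ c) ≤ c ⬝ᵥ (designQFI n U t *ᵥ c) ∧
      c ⬝ᵥ (designQFI n U t *ᵥ c) ≤ optimalScalar d n / (1 - ε) * (c ⬝ᵥ c) := by
  have hd0 : (0 : ℝ) < d := by exact_mod_cast (by omega : 0 < d)
  have hn1 : (1 : ℝ) ≤ n := by exact_mod_cast hn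
  have hm0 : (0 : ℝ) < m := by exact_mod_cast hm
  have hε1 : 0 < 1 - ε := by linarith
  have hTh : (∑ α, (c α : ℂ) • t α).IsHermitian := by
    unfold Matrix.IsHermitian
    rw [Matrix.conjTranspose_sum]
    refine Finset.sum_congr rfl fun α _ => ?_
    rw [Matrix.conjTranspose_smul, (ht.isHermitian α).eq]
    simp
  have hT0 : (∑ α, (c α : ℂ) • t α).trace = 0 := by
    simp [Matrix.trace_sum, ht.trace_eq_zero]
  have h := hU _ hTh hT0
  rw [ht.trace_sum_smul_mul_self] at h
  have hc : 0 ≤ c ⬝ᵥ c := Finset.sum_nonneg fun α _ => mul_self_nonneg (c α)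
  rw [designQFI_quadForm]
  set X := ∑ b, diagWeight (U b : Matrix (Fin d) (Fin d) ℂ) (∑ α, (c α : ℂ) • t α)
  have hcoef : 0 ≤ (n : ℝ) * (n - 1) / (m * d) := by
    have : (0 : ℝ) ≤ n - 1 := by linarith
    positivity
  constructor
  · have h1 := mul_le_mul_of_nonneg_left h.1 hcoef
    have e1 : (n : ℝ) * (n - 1) / (m * d) * (1 / ((1 + ε) * (d + 1)) * m * (c ⬝ᵥ c)) =
        n * (n - 1) / (d * (d + 1)) * (c ⬝ᵥ c) / (1 + ε) := by field_simp
    have e2 : optimalScalar d n / (1 + ε) * (c ⬝ᵥ c) =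
        4 * (n / d * (c ⬝ᵥ c) / (1 + ε) + n * (n - 1) / (d * (d + 1)) * (c ⬝ᵥ c) / (1 + ε)) := by
      unfold optimalScalar
      field_simp
      ring
    have h2 : n / d * (c ⬝ᵥ c) / (1 + ε) ≤ n / d * (c ⬝ᵥ c) :=
      div_le_self (by positivity) (by linarith)
    rw [e2]
    rw [e1] at h1
    linarith
  · have h1 := mul_le_mul_of_nonneg_left h.2 hcoef
    have e1 : (n : ℝ) * (n - 1) / (m * d) * (1 / ((1 - ε) * (d + 1)) * m * (c ⬝ᵥ c)) =
        n * (n - 1) / (d * (d + 1)) * (c ⬝ᵥ c) / (1 - ε) := by field_simp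
    have e2 : optimalScalar d n / (1 - ε) * (c ⬝ᵥ c) =
        4 * (n / d * (c ⬝ᵥ c) / (1 - ε) + n * (n - 1) / (d * (d + 1)) * (c ⬝ᵥ c) / (1 - ε)) := by
      unfold optimalScalar
      field_simp
      ring
    have h2 : n / d * (c ⬝ᵥ c) ≤ n / d * (c ⬝ᵥ c) / (1 - ε) :=
      le_div_self (by positivity) hε1 (by linarith)
    rw [e2]
    rw [e1] at h1
    linarith

variable {Θ : Set (Fin (d ^ 2 - 1) → ℝ)}
  {V : (Fin (d ^ 2 - 1) → ℝ) → Matrix (Fin d) (Fin d) ℂ} {θ : Fin (d ^ 2 - 1) → ℝ}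

theorem IsNormalizedParametrization.isPureModel_designState
    (h : IsNormalizedParametrization Θ V θ) (hd : 2 ≤ d) (hm : 0 < m)
    (U : Fin m → Matrix.unitaryGroup (Fin d) ℂ)
    (hpos : (designQFI n U (generator V θ)).PosDef) :
    IsPureModel (outputState V (designState n U)) θ
      (fun α => outputUnitary (Fin m × Fin d) n (V θ) *
        collective (Fin m × Fin d) n (generator V θ α) *
          (outputUnitary (Fin m × Fin d) n (V θ))ᴴ)
      (designQFI n U (generator V θ))
      (outputUnitary (Fin m × Fin d) n (V θ) *ᵥ designVector n U) := by
  have hV := h.conjTranspose_mul_self h.mem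
  have ht := h.isTracelessBasis
  have hpure : outputState V (designState n U) θ =
      Matrix.vecMulVec (outputUnitary (Fin m × Fin d) n (V θ) *ᵥ designVector n U)
        (star (outputUnitary (Fin m × Fin d) n (V θ) *ᵥ designVector n U)) := by
    rw [Matrix.star_mulVec, ← Matrix.vecMulVec_mul, ← Matrix.mul_vecMulVec]
    rfl
  refine ⟨hpure, ?_, h.isGeneratedBy_outputState _, fun α => ?_, fun α β => ?_, hpos⟩
  · rw [dotProduct_comm, ← Matrix.trace_vecMulVec, ← hpure]
    exact (h.isDensityMatrix_outputState
      (isDensityMatrix_designState (by omega) hm U)).2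
  · rw [outputState_mul_conj hV, trace_designState_mul_collective U (ht.trace_eq_zero α)]
  · rw [conj_mul_conj hV, outputState_mul_conj hV, trace_designState_mul_collective_mul hm,
      ht.trace_mul]
    -- Expectations of selfadjoint matrices are real and `tr(t_α t_β)` is `0` or `1`, so the Gram
    -- matrix is real, as attainment requires.
    have hr : ∀ b k α, (colState (U b : Matrix (Fin d) (Fin d) ℂ) k * generator V θ α).trace =
        ((colState (U b : Matrix (Fin d) (Fin d) ℂ) k * generator V θ α).trace.re : ℂ) :=
      fun b k α => (trace_mul_eq_ofReal_re (colState_isHermitian _ k) (ht.isHermitian α)).symm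
    rw [Finset.sum_congr rfl fun b _ => Finset.sum_congr rfl fun k _ => by
      rw [hr b k α, hr b k β]]
    simp only [designQFI, Matrix.of_apply]
    push_cast
    split_ifs <;> simp

/-- Approximate designs are nearly optimal input states. -/
theorem exists_designState_nearly_optimal (hd : 2 ≤ d) (hn : 1 ≤ n) {ε : ℝ} (hε : 0 < ε)
    (hε2 : ε ≤ 1 / 2)
    (hm : 4 * ((d : ℝ) + 1) * Real.log 2 / ε ^ 2 * Real.log (2 * ((d : ℝ) ^ 2 - 1)) < m) :
    ∃ U : Fin m → Matrix.unitaryGroup (Fin d) ℂ,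
      IsDensityMatrix (designState n U) ∧
      ∀ (Θ : Set (Fin (d ^ 2 - 1) → ℝ)) (V : (Fin (d ^ 2 - 1) → ℝ) → Matrix (Fin d) (Fin d) ℂ)
        (θ : Fin (d ^ 2 - 1) → ℝ), IsNormalizedParametrization Θ V θ →
        (∃ L, IsSLD (outputState V (designState n U)) θ L) ∧
        (∀ L, IsSLD (outputState V (designState n U)) θ L →
          ∀ H, H = quantumFisherInfo (outputState V (designState n U) θ) L →
            H.PosDef ∧ (H⁻¹ - (1 - ε) • (optimalQFI d n)⁻¹).PosSemidef ∧
            ((1 + ε) • (optimalQFI d n)⁻¹ - H⁻¹).PosSemidef) ∧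
        Tendsto (scaledCost V θ (designState n U)) atTop
          (𝓝 (figureOfMerit V θ (designState n U))) ∧
        figureOfMerit V θ (designState n U) ≤ ENNReal.ofReal ((1 + ε) * optimalCost d n) := by
  have hm' := threshold_le hd hε hm
  have hm0 : 0 < m := by
    rcases Nat.eq_zero_or_pos m with rfl | h
    · have : (0 : ℝ) ≤ d := Nat.cast_nonneg d
      norm_num at hm'
      linarith
    · exact h
  obtain ⟨U, hU⟩ := exists_isApproxDesign hd hε hε2 hm'
  refine ⟨U, isDensityMatrix_designState (by omega) hm0 U, fun Θ V θ h => ?_⟩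
  have hh0 := optimalScalar_pos hd hn
  have hε1 : 0 < 1 - ε := by linarith
  have hb := designQFI_quadForm_bounds hd hn hm0 h.isTracelessBasis hε hε2 hU
  have ha0 : 0 < optimalScalar d n / (1 + ε) := by positivity
  have hb0 : 0 < optimalScalar d n / (1 - ε) := by positivity
  have hpos := posDef_of_quadForm_ge (designQFI_isHermitian (n := n) U (generator V θ)) ha0
    fun c => (hb c).1
  have hmodel := h.isPureModel_designState (n := n) hd hm0 U hpos
  have hlower := posSemidef_inv_sub_smul_one hpos hb0 fun c => (hb c).2
  have hupper := posSemidef_smul_one_sub_inv hpos ha0 fun c => (hb c).1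
  have ea : (optimalScalar d n / (1 + ε))⁻¹ = (1 + ε) * (optimalScalar d n)⁻¹ := by
    rw [inv_div, div_eq_mul_inv]
  have eb : (optimalScalar d n / (1 - ε))⁻¹ = (1 - ε) * (optimalScalar d n)⁻¹ := by
    rw [inv_div, div_eq_mul_inv]
  rw [ea] at hupper
  rw [eb] at hlower
  have hp : 0 < d ^ 2 - 1 := by
    have : 2 ^ 2 ≤ d ^ 2 := Nat.pow_le_pow_left hd 2
    omega
  have hcost : ∀ N : ℕ, 0 < N → scaledCost V θ (designState n U) N =
      ENNReal.ofReal (designQFI n U (generator V θ))⁻¹.trace := fun N hN =>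
    hmodel.mul_iInf_traceInv hp hN
  -- The scaled cost is constant for `N ≥ 1`, so the limit exists and equals the lower limit.
  have htend : Tendsto (scaledCost V θ (designState n U)) atTop
      (𝓝 (ENNReal.ofReal (designQFI n U (generator V θ))⁻¹.trace)) := by
    refine tendsto_const_nhds.congr' ?_
    filter_upwards [eventually_gt_atTop 0] with N hN
    rw [hcost N hN]
  have hfig : figureOfMerit V θ (designState n U) =
      ENNReal.ofReal (designQFI n U (generator V θ))⁻¹.trace := htend.liminf_eq
  refine ⟨hmodel.exists_isSLD, fun L hL H hH => ?_, hfig ▸ htend, ?_⟩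
  · rw [hmodel.quantumFisherInfo_eq hL] at hH
    subst hH
    rw [optimalQFI_inv hd hn, smul_smul, smul_smul]
    exact ⟨hpos, hlower, hupper⟩
  · rw [hfig]
    refine ENNReal.ofReal_le_ofReal ?_
    have h1 := hupper.trace_nonneg
    rw [Matrix.trace_sub, Matrix.trace_smul, Matrix.trace_one, Fintype.card_fin, smul_eq_mul,
      mul_assoc, card_mul_inv_optimalScalar hd hn] at h1
    linarith

theorem optimalCost_pos (hd : 2 ≤ d) (hn : 1 ≤ n) : 0 < optimalCost d n := by
  have hd2 : (2 : ℝ) ≤ d := by exact_mod_cast hd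
  have : (0 : ℝ) < n := by exact_mod_cast hn
  have : (0 : ℝ) < d - 1 := by linarith
  unfold optimalCost
  positivity

end DesignState

end UnitaryEstimation

end

theorem mainTheorem4 (d n : ℕ) (hd : 2 ≤ d) (hn : 1 ≤ n) :
    -- above the threshold, some unitaries satisfy the operator bounds and the bound on the cost
    (∀ (ε : ℝ) (m : ℕ), 0 < ε → ε ≤ 1 / 2 →
      4 * ((d : ℝ) + 1) * Real.log 2 / ε ^ 2 * Real.log (2 * ((d : ℝ) ^ 2 - 1)) < m →
      ∃ U : Fin m → Matrix.unitaryGroup (Fin d) ℂ,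
        UnitaryEstimation.IsDensityMatrix (UnitaryEstimation.designState n U) ∧
        ∀ (Θ : Set (Fin (d ^ 2 - 1) → ℝ))
          (V : (Fin (d ^ 2 - 1) → ℝ) → Matrix (Fin d) (Fin d) ℂ) (θ : Fin (d ^ 2 - 1) → ℝ),
          UnitaryEstimation.IsNormalizedParametrization Θ V θ →
          (∃ L, UnitaryEstimation.IsSLD
            (UnitaryEstimation.outputState V (UnitaryEstimation.designState n U)) θ L) ∧
          (∀ L, UnitaryEstimation.IsSLD
              (UnitaryEstimation.outputState V (UnitaryEstimation.designState n U)) θ L →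
            ∀ H, H = UnitaryEstimation.quantumFisherInfo
                (UnitaryEstimation.outputState V (UnitaryEstimation.designState n U) θ) L →
              H.PosDef ∧
              (H⁻¹ - (1 - ε) • (UnitaryEstimation.optimalQFI d n)⁻¹).PosSemidef ∧
              ((1 + ε) • (UnitaryEstimation.optimalQFI d n)⁻¹ - H⁻¹).PosSemidef) ∧
          Tendsto (UnitaryEstimation.scaledCost V θ (UnitaryEstimation.designState n U)) atTop
            (𝓝 (UnitaryEstimation.figureOfMerit V θ (UnitaryEstimation.designState n U))) ∧
          UnitaryEstimation.figureOfMerit V θ (UnitaryEstimation.designState n U) ≤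
            ENNReal.ofReal ((1 + ε) * UnitaryEstimation.optimalCost d n)) ∧
    -- no input state, with any ancilla, has a smaller cost than the optimal one
    (∀ (Θ : Set (Fin (d ^ 2 - 1) → ℝ))
        (V : (Fin (d ^ 2 - 1) → ℝ) → Matrix (Fin d) (Fin d) ℂ) (θ : Fin (d ^ 2 - 1) → ℝ),
        UnitaryEstimation.IsNormalizedParametrization Θ V θ →
        ∀ (a : ℕ) (ω : Matrix (Fin a × (Fin n → Fin d)) (Fin a × (Fin n → Fin d)) ℂ),
          UnitaryEstimation.IsDensityMatrix ω →
          ENNReal.ofReal (UnitaryEstimation.optimalCost d n) ≤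
            UnitaryEstimation.figureOfMerit V θ ω) ∧
    -- hence approximate designs come arbitrarily close to optimality as `m` grows
    (∀ δ : ℝ, 0 < δ → ∃ m₀ : ℕ, ∀ m : ℕ, m₀ ≤ m →
      ∃ U : Fin m → Matrix.unitaryGroup (Fin d) ℂ,
        UnitaryEstimation.IsDensityMatrix (UnitaryEstimation.designState n U) ∧
        ∀ (Θ : Set (Fin (d ^ 2 - 1) → ℝ))
          (V : (Fin (d ^ 2 - 1) → ℝ) → Matrix (Fin d) (Fin d) ℂ) (θ : Fin (d ^ 2 - 1) → ℝ),
          UnitaryEstimation.IsNormalizedParametrization Θ V θ →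
          ENNReal.ofReal (UnitaryEstimation.optimalCost d n) ≤
            UnitaryEstimation.figureOfMerit V θ (UnitaryEstimation.designState n U) ∧
          UnitaryEstimation.figureOfMerit V θ (UnitaryEstimation.designState n U) ≤
            ENNReal.ofReal (UnitaryEstimation.optimalCost d n + δ)) := by
  refine ⟨fun ε m hε hε2 hm =>
    UnitaryEstimation.exists_designState_nearly_optimal hd hn hε hε2 hm,
    fun Θ V θ h a ω hω => h.optimalCost_le_figureOfMerit hd hn hω, fun δ hδ => ?_⟩
  have hc := UnitaryEstimation.optimalCost_pos hd hn
  -- This `ε` keeps the excess `ε · optimalCost` at most `δ` and stays within the range `ε ≤ 1/2`.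
  have hε : 0 < min (1 / 2) (δ / UnitaryEstimation.optimalCost d n) :=
    lt_min (by norm_num) (by positivity)
  obtain ⟨m₀, hm₀⟩ := exists_nat_gt (4 * ((d : ℝ) + 1) * Real.log 2 /
    (min (1 / 2) (δ / UnitaryEstimation.optimalCost d n)) ^ 2 *
      Real.log (2 * ((d : ℝ) ^ 2 - 1)))
  refine ⟨m₀, fun m hm => ?_⟩
  obtain ⟨U, hU, hUV⟩ := UnitaryEstimation.exists_designState_nearly_optimal hd hn hε
    (min_le_left _ _) (hm₀.trans_le (by exact_mod_cast hm : (m₀ : ℝ) ≤ m))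
  refine ⟨U, hU, fun Θ V θ h => ⟨h.optimalCost_le_figureOfMerit hd hn hU, ?_⟩⟩
  refine (hUV Θ V θ h).2.2.2.trans (ENNReal.ofReal_le_ofReal ?_)
  have h1 : min (1 / 2) (δ / UnitaryEstimation.optimalCost d n) *
      UnitaryEstimation.optimalCost d n ≤ δ := by
    rw [← le_div_iff₀ hc]
    exact min_le_right _ _
  linarith
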